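/- Let $A$ be a unital and separable C$^*$-algebra of stable rank one, i.e. the invertible elements of $A$ are dense in $A$. Let $M_\infty(A)=\bigcup_n M_n(A)$, where $a\in M_n(A)$ is identified with $\mathrm{diag}(a,0)\in M_{n+1}(A)$. For positive $a,b\in M_\infty(A)$ write $a\precsim b$ if there is a sequence $(v_n)$ in $M_\infty(A)$ with $\|v_nbv_n^*-a\|\to 0$. Let $W(A)$ be the set of classes $\langle a\rangle$ of positive elements of $M_\infty(A)$ for the relation "$a\precsim b$ and $b\precsim a$", partially ordered by $\langle a\rangle\le\langle b\rangle\iff a\precsim b$. Let $T(A)$ be the set of normalised traces on $A$, that is, of linear functionals $\tau$ on $A$ with $\tau(x^*x)=\tau(xx^*)\ge 0$ for all $x\in A$ and $\tau(1)=1$; extend each $\tau \in T(A)$ to $M_\infty(A)$ by $\tau((a_{ij}))=\sum_i\tau(a_{ii})$, and put $d_\tau(a)=\lim_{n\to\infty}\tau(a^{1/n})$ for positive $a\in M_\infty(A)$. Then every increasing sequence $\langle a_1\rangle\le\langle a_2\rangle\le\cdots$ in $W(A)$ that is bounded above in $W(A)$ has a supremum in $W(A)$. Moreover, if $a_\infty$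 is any positive element of $M_\infty(A)$ with $\langle a_\infty\rangle=\sup_n\langle a_n\rangle$, then $d_\tau(a_\infty)=\sup_n d_\tau(a_n)$ for every $\tau\in T(A)$. -/

import Mathlib

open Filter Topology
open scoped NNReal ComplexOrder

namespace Cuntz

section Matrices

variable {A : Type*} [CStarAlgebra A]

/-- The matrix `diag(a, 0)` of size `n`, for a matrix `a` of size `m ≤ n`. -/
def padMat {m : ℕ} (n : ℕ) (a : CStarMatrix (Fin m) (Fin m) A) : CStarMatrix (Fin n) (Fin n) A :=
  CStarMatrix.ofMatrix fun i j =>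
    if hij : i.1 < m ∧ j.1 < m then a ⟨i.1, hij.1⟩ ⟨j.1, hij.2⟩ else 0

theorem padMat_apply {m n : ℕ} (a : CStarMatrix (Fin m) (Fin m) A) (i j : Fin n) :
    padMat n a i j = if hij : i.1 < m ∧ j.1 < m then a ⟨i.1, hij.1⟩ ⟨j.1, hij.2⟩ else 0 := rfl

/-- The connecting map `a ↦ diag(a, 0)` from `M_m(A)` to `M_n(A)`, for `m ≤ n`. -/
def pad {m n : ℕ} (h : m ≤ n) :
    CStarMatrix (Fin m) (Fin m) A →⋆ₙₐ[ℂ] CStarMatrix (Fin n) (Fin n) A where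
  toFun a := padMat n a
  map_smul' c a := by
    ext i j
    by_cases hij : i.1 < m ∧ j.1 < m <;> simp [padMat_apply, hij]
  map_zero' := by
    ext i j
    simp [padMat_apply]
  map_add' a b := by
    ext i j
    by_cases hij : i.1 < m ∧ j.1 < m <;> simp [padMat_apply, hij]
  map_mul' a b := by
    ext i j
    simp only [padMat_apply, CStarMatrix.mul_apply]
    by_cases hij : i.1 < m ∧ j.1 < m
    · rw [dif_pos hij]
      refine Finset.sum_of_injOn (Fin.castLE h) (Fin.castLE_injective h).injOn (by simp) ?_ ?_
      · intro k _ hk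
        have hk' : ¬ k.1 < m := fun hlt => hk ⟨⟨k.1, hlt⟩, by simp, by ext; simp⟩
        simp [hk']
      · intro k _
        simp [hij.1, hij.2]
    · rw [dif_neg hij]
      symm
      refine Finset.sum_eq_zero fun k _ => ?_
      rcases not_and_or.mp hij with h1 | h1 <;> simp [h1]
  map_star' a := by
    ext i j
    by_cases hij : i.1 < m ∧ j.1 < m
    · simp [CStarMatrix.star_apply, padMat_apply, hij]
    · have hji : ¬ (j.1 < m ∧ i.1 < m) := fun h' => hij h'.symm
      simp [CStarMatrix.star_apply, padMat_apply, hij, hji]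

theorem pad_apply {m n : ℕ} (h : m ≤ n) (a : CStarMatrix (Fin m) (Fin m) A) (i j : Fin n) :
    pad h a i j = if hij : i.1 < m ∧ j.1 < m then a ⟨i.1, hij.1⟩ ⟨j.1, hij.2⟩ else 0 := rfl

theorem pad_pad {l m n : ℕ} (h : l ≤ m) (h' : m ≤ n) (a : CStarMatrix (Fin l) (Fin l) A) :
    pad h' (pad h a) = pad (h.trans h') a := by
  ext i j
  simp only [pad_apply]
  by_cases hij : i.1 < l ∧ j.1 < l
  · simp [hij, hij.1.trans_le h, hij.2.trans_le h]
  · simp [hij]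

theorem norm_pad [PartialOrder A] [StarOrderedRing A] {m n : ℕ} (h : m ≤ n) (a : CStarMatrix (Fin m) (Fin m) A) :
    ‖pad h a‖ = ‖a‖ := by
  refine NonUnitalStarAlgHom.norm_map (pad h) (fun a b hab => ?_) a
  ext i j
  have := congrArg (fun M : CStarMatrix (Fin n) (Fin n) A => M (Fin.castLE h i) (Fin.castLE h j)) hab
  simpa [pad_apply] using this

end Matrices

section Semigroup

variable (A : Type*) [CStarAlgebra A] [PartialOrder A] [StarOrderedRing A]

/-- A positive element of `M_∞(A) = ⋃ₙ Mₙ(A)`, given by a positive matrix of some finite size.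
A matrix and its enlargements by zeros represent the same element of `M_∞(A)`. -/
structure PosMat where
  /-- the size of the matrix -/
  size : ℕ
  /-- the matrix -/
  mat : CStarMatrix (Fin size) (Fin size) A
  nonneg : 0 ≤ mat

variable {A}

/-- Cuntz subequivalence: there is a sequence `v k` of elements of `M_∞(A)` such that
`‖v k * b * (v k)^* - a‖ → 0`. Here `v k` is a matrix of some size `N k`, which may be
taken at least as large as the sizes of `a` and `b`, and the expression is computed
in `M_{N k}(A)`. -/
def Subequiv (a b : PosMat A) : Prop :=
  ∃ (N : ℕ → ℕ) (ha : ∀ k, a.size ≤ N k) (hb : ∀ k, b.size ≤ N k)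
    (v : ∀ k, CStarMatrix (Fin (N k)) (Fin (N k)) A),
    Tendsto (fun k => ‖v k * pad (hb k) b.mat * star (v k) - pad (ha k) a.mat‖) atTop (𝓝 0)

theorem subequiv_iff (a b : PosMat A) :
    Subequiv a b ↔ ∀ ε : ℝ, 0 < ε → ∃ (N : ℕ) (ha : a.size ≤ N) (hb : b.size ≤ N)
      (v : CStarMatrix (Fin N) (Fin N) A),
      ‖v * pad hb b.mat * star v - pad ha a.mat‖ < ε := by
  constructor
  · rintro ⟨N, ha, hb, v, hv⟩ ε hε
    obtain ⟨k, hk⟩ := (hv.eventually (gt_mem_nhds hε)).exists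
    exact ⟨N k, ha k, hb k, v k, hk⟩
  · intro h
    choose N ha hb v hv using fun k : ℕ => h (1 / ((k : ℝ) + 1)) (by positivity)
    exact ⟨N, ha, hb, v, squeeze_zero (fun _ => norm_nonneg _) (fun k => (hv k).le)
      tendsto_one_div_add_atTop_nhds_zero_nat⟩

theorem Subequiv.refl (a : PosMat A) : Subequiv a a :=
  ⟨fun _ => a.size, fun _ => le_rfl, fun _ => le_rfl, fun _ => 1, by simp⟩

theorem Subequiv.trans {a b c : PosMat A} (hab : Subequiv a b) (hbc : Subequiv b c) :
    Subequiv a c := by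
  rw [subequiv_iff] at *
  intro ε hε
  obtain ⟨N, ha, hb, v, hv⟩ := hab (ε / 2) (half_pos hε)
  obtain ⟨N', hb', hc, w, hw⟩ := hbc (ε / 2 / (‖v‖ * ‖v‖ + 1)) (by positivity)
  have h1 : N ≤ max N N' := le_max_left _ _
  have h2 : N' ≤ max N N' := le_max_right _ _
  refine ⟨max N N', ha.trans h1, hc.trans h2, pad h1 v * pad h2 w, ?_⟩
  have key : pad h1 v * pad h2 w * pad (hc.trans h2) c.mat * star (pad h1 v * pad h2 w)
      - pad (ha.trans h1) a.mat
      = pad h1 v * pad h2 (w * pad hc c.mat * star w - pad hb' b.mat) * star (pad h1 v)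
        + pad h1 (v * pad hb b.mat * star v - pad ha a.mat) := by
    simp only [map_sub, map_mul, map_star, pad_pad, star_mul]
    noncomm_ring
  rw [key]
  have e1 : ‖pad h1 v * pad h2 (w * pad hc c.mat * star w - pad hb' b.mat) * star (pad h1 v)‖
      ≤ ‖v‖ * ‖v‖ * ‖w * pad hc c.mat * star w - pad hb' b.mat‖ := by
    refine (norm_mul_le _ _).trans ?_
    rw [norm_star, norm_pad]
    refine (mul_le_mul_of_nonneg_right (norm_mul_le _ _) (norm_nonneg _)).trans ?_
    rw [norm_pad, norm_pad]
    exact le_of_eq (by ring)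
  have e2 : ‖v‖ * ‖v‖ * ‖w * pad hc c.mat * star w - pad hb' b.mat‖ ≤ ε / 2 := by
    rw [lt_div_iff₀ (by positivity)] at hw
    nlinarith [norm_nonneg (w * pad hc c.mat * star w - pad hb' b.mat)]
  refine (norm_add_le _ _).trans_lt ?_
  rw [norm_pad]
  linarith

/-- Positive elements of `M_∞(A)` preordered by Cuntz subequivalence. -/
instance : Preorder (PosMat A) where
  le := Subequiv
  le_refl := Subequiv.refl
  le_trans _ _ _ := Subequiv.trans

variable (A) in
/-- The Cuntz semigroup `W(A)` as an ordered set: Cuntz equivalence classes (`a ≾ b` and `b ≾ a`)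
of positive elements of `M_∞(A)`, ordered by `⟨a⟩ ≤ ⟨b⟩ ↔ a ≾ b`. -/
abbrev W : Type _ := Antisymmetrization (PosMat A) (· ≤ ·)

/-- The class `⟨a⟩` in `W(A)`. -/
def cls (a : PosMat A) : W A := toAntisymmetrization (· ≤ ·) a

theorem cls_le_cls (a b : PosMat A) : cls a ≤ cls b ↔ Subequiv a b := Iff.rfl

theorem cls_eq_cls (a b : PosMat A) : cls a = cls b ↔ Subequiv a b ∧ Subequiv b a := by
  rw [le_antisymm_iff, cls_le_cls, cls_le_cls]

end Semigroup

section Traces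

variable (A : Type*) [CStarAlgebra A]

/-- The set `T(A)` of normalised traces on a unital C⋆-algebra. -/
structure TracialState extends A →ₗ[ℂ] ℂ where
  nonneg' : ∀ x : A, 0 ≤ toFun (star x * x)
  tracial' : ∀ x : A, toFun (star x * x) = toFun (x * star x)
  map_one' : toFun 1 = 1

variable {A}

/-- The canonical (unnormalised) extension of a trace to `M_n(A)`: the sum of the values
of the trace on the diagonal entries. Positive elements have real values, so we
take the real part. -/
noncomputable def matTrace (τ : TracialState A) {n : ℕ} (a : CStarMatrix (Fin n) (Fin n) A) : ℝ :=
  (∑ i, τ.toLinearMap (a i i)).re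

/-- The root `b^{1/n}` of a positive element of a C⋆-algebra. -/
noncomputable def root {B : Type*} [CStarAlgebra B] [PartialOrder B] [StarOrderedRing B]
    (n : ℕ) (b : B) : B := CFC.nnrpow b (1 / (n : ℝ≥0))

variable [PartialOrder A] [StarOrderedRing A]

/-- The dimension function `d_τ(a) = lim_{n → ∞} τ(a^{1/n})` on positive elements of `M_∞(A)`.
The limit always exists, see `tendsto_dimFn`. -/
noncomputable def dimFn (τ : TracialState A) (a : PosMat A) : ℝ :=
  limUnder atTop fun n : ℕ => matTrace τ (root n a.mat)

theorem exists_tendsto_root {B : Type*} [CStarAlgebra B] [PartialOrder B] [StarOrderedRing B]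
    (φ : B →ₗ[ℝ] ℝ) (hφ : ∀ x : B, 0 ≤ x → 0 ≤ φ x) (b : B) (hb : 0 ≤ b) :
    ∃ l : ℝ, Tendsto (fun n : ℕ => φ (root n b)) atTop (𝓝 l) := by
  have hφm : ∀ x y : B, x ≤ y → φ x ≤ φ y := fun x y hxy => by
    have := hφ (y - x) (sub_nonneg.mpr hxy)
    rw [map_sub] at this
    linarith
  rcases eq_or_ne b 0 with rfl | hb0
  · exact ⟨0, by simp [root, CFC.nnrpow_eq_pow]⟩
  have hc : 0 < ‖b‖₊ := by simpa [pos_iff_ne_zero] using hb0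
  set c : ℝ≥0 := ‖b‖₊ with hcdef
  let e : ℕ → ℝ≥0 := fun n => 1 / ((n + 1 : ℕ) : ℝ≥0)
  have he : ∀ n, 0 < e n := fun n => by positivity
  have hcont : ∀ n, Continuous fun x : ℝ≥0 => NNReal.nnrpow x (e n) := fun n =>
    NNReal.continuous_nnrpow_const _
  let g : ℕ → B := fun n => cfcₙ (fun x : ℝ≥0 => (c ^ (e n : ℝ))⁻¹ * NNReal.nnrpow x (e n)) b
  have hz : ∀ n, NNReal.nnrpow 0 (e n) = 0 := fun n => by
    simp [(he n).ne']
  have hg : ∀ n, root (n + 1) b = (c ^ (e n : ℝ)) • g n := by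
    intro n
    have h1 : g n = (c ^ (e n : ℝ))⁻¹ • root (n + 1) b :=
      cfcₙ_const_mul _ _ _ (hcont n).continuousOn (hz n)
    rw [h1, smul_smul, mul_inv_cancel₀ (by positivity), one_smul]
  have hfeq : ∀ (n : ℕ) (x : ℝ≥0),
      (c ^ (e n : ℝ))⁻¹ * NNReal.nnrpow x (e n) = (x / c) ^ (e n : ℝ) := fun n x => by
    rw [NNReal.div_rpow, NNReal.nnrpow_def, div_eq_inv_mul]
  have hcx : ∀ x ∈ quasispectrum ℝ≥0 b, x / c ≤ 1 := fun x hx =>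
    div_le_one_of_le₀ (CStarAlgebra.le_nnnorm_of_mem_quasispectrum hx) zero_le
  have hgmono : Monotone g := by
    refine monotone_nat_of_le_succ fun n => ?_
    refine cfcₙ_mono (fun x hx => ?_) ((hcont n).const_mul _ |>.continuousOn)
      ((hcont (n + 1)).const_mul _ |>.continuousOn) (by simp [(he n).ne']) (by simp [(he _).ne'])
    rw [hfeq, hfeq]
    have h1 : (e (n + 1) : ℝ) ≤ e n := by
      norm_cast
      exact one_div_le_one_div_of_le (by positivity) (by push_cast; gcongr; simp)
    exact_mod_cast Real.rpow_le_rpow_of_exponent_ge' (x := ((x / c : ℝ≥0) : ℝ)) (by positivity)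
      (by exact_mod_cast hcx x hx) (by positivity) h1
  have hgle : ∀ n, g n ≤ 1 := by
    intro n
    have hg0 : 0 ≤ g n := cfcₙ_predicate _ b
    rw [← CStarAlgebra.norm_le_one_iff_of_nonneg (g n) hg0]
    have : ‖g n‖₊ ≤ 1 := nnnorm_cfcₙ_nnreal_le fun x hx => by
      rw [hfeq]
      exact NNReal.rpow_le_one (hcx x hx) (by positivity)
    exact_mod_cast this
  have hlim : Tendsto (fun n => φ (g n)) atTop (𝓝 (⨆ n, φ (g n))) := by
    refine tendsto_atTop_ciSup (fun i j hij => hφm _ _ (hgmono hij)) ⟨φ 1, ?_⟩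
    rintro _ ⟨n, rfl⟩
    exact hφm _ _ (hgle n)
  refine ⟨1 * ⨆ n, φ (g n), ?_⟩
  rw [← tendsto_add_atTop_iff_nat 1]
  have hpow : Tendsto (fun n => ((c ^ (e n : ℝ) : ℝ≥0) : ℝ)) atTop (𝓝 1) := by
    have h0 : Tendsto (fun n => (e n : ℝ)) atTop (𝓝 0) := by
      simpa [e] using tendsto_one_div_add_atTop_nhds_zero_nat (𝕜 := ℝ)
    have := (Real.continuousAt_const_rpow (a := (c : ℝ)) (b := 0)
      (by exact_mod_cast hc.ne')).tendsto.comp h0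
    simpa [Function.comp_def] using this
  refine (hpow.mul hlim).congr fun n => ?_
  rw [hg, NNReal.smul_def, map_smul, smul_eq_mul]

theorem exists_eq_star_mul_self {B : Type*} [CStarAlgebra B] [PartialOrder B] [StarOrderedRing B]
    {b : B} (hb : 0 ≤ b) : ∃ y, b = star y * y :=
  CStarAlgebra.nonneg_iff_eq_star_mul_self.mp hb

theorem matTrace_nonneg (τ : TracialState A) {n : ℕ} (a : CStarMatrix (Fin n) (Fin n) A)
    (ha : 0 ≤ a) : 0 ≤ matTrace τ a := by
  obtain ⟨b, rfl⟩ := exists_eq_star_mul_self ha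
  have h : 0 ≤ ∑ i, τ.toLinearMap ((star b * b) i i) := by
    refine Finset.sum_nonneg fun i _ => ?_
    rw [CStarMatrix.mul_apply, map_sum]
    refine Finset.sum_nonneg fun k _ => ?_
    rw [CStarMatrix.star_apply]
    exact τ.nonneg' (b k i)
  exact (Complex.le_def.mp h).1

theorem tendsto_dimFn (τ : TracialState A) (a : PosMat A) :
    Tendsto (fun n : ℕ => matTrace τ (root n a.mat)) atTop (𝓝 (dimFn τ a)) := by
  let φ : CStarMatrix (Fin a.size) (Fin a.size) A →ₗ[ℝ] ℝ :=
    { toFun := fun x => matTrace τ x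
      map_add' := fun x y => by simp [matTrace, Finset.sum_add_distrib]
      map_smul' := fun r x => by
        have : ∀ i, (r • x) i i = (r : ℂ) • x i i := fun i => rfl
        simp [matTrace, this, Finset.mul_sum] }
  exact tendsto_nhds_limUnder
    (exists_tendsto_root φ (fun x hx => matTrace_nonneg τ x hx) a.mat a.nonneg)

end Traces

end Cuntz

/-!
Write `a ≾ b` in terms of rectangular matrices: `a` lies in the closure of
`conjSet b = {v b v⋆}` (`subequiv_iff_mem_closure`). It suffices to find a positive matrix `s` with
`a n ≾ s` for all `n` and with `s` in the closure of `⋃ n, conjSet (a n)`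
(`exists_upperBound_mem_closure`). If `a n ≾ b` for all `n`, then `s ≾ b` by transitivity, so `⟨s⟩`
is the supremum (`isLUB_of_mem_closure`). The statement on traces follows from the same description
of `s`, because the dimension function is monotone and lower semicontinuous in the sense of
`dimFn_le_of_mem_closure`.

Construction of `s`. Let `c` of size `k` be an upper bound. The algebra `M_k(A)` has stable rank one
too (`dense_isUnit_cstarMatrix_fin`, by Schur complements). As `a m ≾ c`, the matrix `a m` is
approximated by conjugates of positive `b ∈ M_k(A)` with `b ≾ a m`
(`mem_closure_conj_of_mem_closure_conjSet`). Stable rank one enters through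
`exists_conj_near_of_dense_isUnit`: if `y` is close to an invertible element with unitary polar part
`w⋆`, then `w y y⋆ w⋆` is close to `y⋆ y`. Thus, given `x ∈ M_k(A)` with `x x⋆ ≾ a m`, one can
rotate the next `b` by a unitary such that `x` is close to a right multiple, with a contractive
multiplier, of `x' = w √b` up to a scalar. Iterating with rapidly decreasing errors and passing to
the limit (`exists_limit_of_approx_mul`) gives `y m` with `y m = y (m + 1) * t m` and `‖t m‖ ≤ 1`, hence an
increasing sequence `h m = y m (y m)⋆` of matrices of fixed size (`exists_monotone_approx`), and `s`
is a weighted sum of the `h m` (`exists_dominating_of_monotone`).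

Traces. The value `d_τ(a)` is also the supremum over `δ > 0` of `τ(a (a + δ)⁻¹)`
(`limit_root_le_iff`). The function `a ↦ a (a + δ)⁻¹` is norm continuous and operator monotone, and
`τ(y y⋆ (y y⋆ + δ)⁻¹) = τ(y⋆ y (y⋆ y + δ)⁻¹)`. If `a` is near `v b v⋆ = y y⋆`, then `y⋆ y` is
dominated by a multiple of `b`, whence the comparison of `d_τ(a)` with `d_τ(b)`.
-/

namespace Cuntz

/-! ### Resolvents, domination and unitary conjugation in C⋆-algebras -/

section CStarAlgebra

theorem norm_le_one_of_star_mul_self_eq_one {B : Type*} [CStarAlgebra B] {w : B}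
    (hw : star w * w = 1) : ‖w‖ ≤ 1 := by
  have h : ‖w‖ * ‖w‖ = ‖(1 : B)‖ := by rw [← CStarRing.norm_star_mul_self, hw]
  have h1 : ‖(1 : B)‖ ≤ 1 := by
    have : ‖(1 : B)‖ * ‖(1 : B)‖ = ‖(1 : B)‖ := by
      rw [← CStarRing.norm_star_mul_self, star_one, one_mul]
    nlinarith [norm_nonneg (1 : B)]
  nlinarith [norm_nonneg w]

variable {B : Type*} [CStarAlgebra B] [PartialOrder B] [StarOrderedRing B]

theorem exists_isSelfAdjoint_mul_self {b : B} (hb : 0 ≤ b) : ∃ r : B, star r = r ∧ r * r = b :=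
  ⟨CFC.sqrt b, (IsSelfAdjoint.of_nonneg (CFC.sqrt_nonneg b)).star_eq, CFC.sqrt_mul_sqrt_self b hb⟩

theorem continuousOn_spectrum_of_nonneg {f : ℝ → ℝ} (hf : ContinuousOn f (Set.Ici 0)) {b : B}
    (hb : 0 ≤ b) : ContinuousOn f (spectrum ℝ b) :=
  hf.mono fun _ ht => spectrum_nonneg_of_nonneg hb ht

theorem continuousOn_inv_add {δ : ℝ} (hδ : 0 < δ) :
    ContinuousOn (fun t : ℝ => (t + δ)⁻¹) (Set.Ici 0) :=
  ContinuousOn.inv₀ (by fun_prop) fun t ht => (add_pos_of_nonneg_of_pos ht hδ).ne'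

theorem continuousOn_div_add {δ : ℝ} (hδ : 0 < δ) :
    ContinuousOn (fun t : ℝ => t / (t + δ)) (Set.Ici 0) :=
  ContinuousOn.div (by fun_prop) (by fun_prop) fun t ht => (add_pos_of_nonneg_of_pos ht hδ).ne'

/-- The resolvent `(b + δ)⁻¹` of a positive element, for `δ > 0`. It is defined by the functional
calculus, so that products with `b` are again values of the functional calculus. -/
noncomputable def shiftInv (δ : ℝ) (b : B) : B := cfc (fun t : ℝ => (t + δ)⁻¹) b

theorem shiftInv_nonneg {δ : ℝ} (hδ : 0 < δ) {b : B} (hb : 0 ≤ b) : 0 ≤ shiftInv δ b :=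
  cfc_nonneg fun t ht => by
    have := spectrum_nonneg_of_nonneg hb ht
    positivity

theorem mul_shiftInv {δ : ℝ} (hδ : 0 < δ) {b : B} (hb : 0 ≤ b) :
    b * shiftInv δ b = cfc (fun t : ℝ => t / (t + δ)) b := by
  simp_rw [div_eq_mul_inv]
  rw [cfc_mul (fun t : ℝ => t) _ b (by fun_prop)
    (continuousOn_spectrum_of_nonneg (continuousOn_inv_add hδ) hb), cfc_id' ℝ b, shiftInv]

theorem commute_shiftInv (δ : ℝ) {b : B} (hb : 0 ≤ b) : Commute (shiftInv δ b) b := by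
  have := cfc_commute_cfc (fun t : ℝ => (t + δ)⁻¹) (fun t : ℝ => t) b
  rwa [cfc_id' ℝ b] at this

theorem shiftInv_mul {δ : ℝ} (hδ : 0 < δ) {b : B} (hb : 0 ≤ b) :
    shiftInv δ b * b = cfc (fun t : ℝ => t / (t + δ)) b := by
  rw [← mul_shiftInv hδ hb, (commute_shiftInv δ hb).eq]

theorem mul_shiftInv_add {δ : ℝ} (hδ : 0 < δ) {b : B} (hb : 0 ≤ b) :
    b * shiftInv δ b + δ • shiftInv δ b = 1 := by
  rw [mul_shiftInv hδ hb, shiftInv, ← cfc_const_mul δ _ b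
    (continuousOn_spectrum_of_nonneg (continuousOn_inv_add hδ) hb), ← cfc_add (a := b) _ _
    (continuousOn_spectrum_of_nonneg (continuousOn_div_add hδ) hb)
    ((continuousOn_spectrum_of_nonneg (continuousOn_inv_add hδ) hb).const_mul δ),
    ← cfc_const_one ℝ b]
  refine cfc_congr fun t ht => ?_
  have := spectrum_nonneg_of_nonneg hb ht
  field_simp

theorem shiftInv_mul_add {δ : ℝ} (hδ : 0 < δ) {b : B} (hb : 0 ≤ b) :
    shiftInv δ b * b + δ • shiftInv δ b = 1 := by
  rw [shiftInv_mul hδ hb, ← mul_shiftInv hδ hb, mul_shiftInv_add hδ hb]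

theorem norm_smul_shiftInv_le {δ : ℝ} (hδ : 0 < δ) {b : B} (hb : 0 ≤ b) :
    ‖δ • shiftInv δ b‖ ≤ 1 := by
  rw [shiftInv, ← cfc_const_mul δ _ b
    (continuousOn_spectrum_of_nonneg (continuousOn_inv_add hδ) hb)]
  refine norm_cfc_le zero_le_one fun t ht => ?_
  have := spectrum_nonneg_of_nonneg hb ht
  rw [Real.norm_of_nonneg (by positivity), ← div_eq_mul_inv, div_le_one (by positivity)]
  linarith

theorem norm_mul_shiftInv_le {δ : ℝ} (hδ : 0 < δ) {b : B} (hb : 0 ≤ b) :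
    ‖b * shiftInv δ b‖ ≤ 1 := by
  rw [mul_shiftInv hδ hb]
  refine norm_cfc_le zero_le_one fun t ht => ?_
  have := spectrum_nonneg_of_nonneg hb ht
  rw [Real.norm_of_nonneg (by positivity), div_le_one (by positivity)]
  linarith

/-- If `x x⋆` is within `η` of a positive element `p ≤ C h`, then `h (h + δ)⁻¹` almost fixes `x`
from the left. -/
theorem norm_sub_mul_shiftInv_sq_le {δ : ℝ} (hδ : 0 < δ) {h p x : B} (hh : 0 ≤ h) (hp : 0 ≤ p)
    {C η : ℝ} (hC : 0 ≤ C) (hph : p ≤ C • h) (hx : ‖x * star x - p‖ ≤ η) :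
    ‖x - h * (shiftInv δ h * x)‖ ^ 2 ≤ C * δ + η := by
  set d := δ • shiftInv δ h with hd
  have hd0 : 0 ≤ d := smul_nonneg hδ.le (shiftInv_nonneg hδ hh)
  have hds : star d = d := (IsSelfAdjoint.of_nonneg hd0).star_eq
  have hd1 : ‖d‖ ≤ 1 := norm_smul_shiftInv_le hδ hh
  have e1 : x - h * (shiftInv δ h * x) = d * x := by
    rw [← mul_assoc, eq_sub_of_add_eq (mul_shiftInv_add hδ hh)]
    rw [sub_mul, one_mul, sub_sub_cancel]
  have hdh : ‖d * h * d‖ ≤ δ := by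
    have : d * h * d = δ • (d * (h * shiftInv δ h)) := by
      rw [hd]; simp only [mul_smul_comm, smul_mul_assoc, mul_assoc]
    rw [this, norm_smul, Real.norm_of_nonneg hδ.le]
    calc δ * ‖d * (h * shiftInv δ h)‖ ≤ δ * (‖d‖ * ‖h * shiftInv δ h‖) := by
          gcongr; exact norm_mul_le _ _
      _ ≤ δ * (1 * 1) := by
          gcongr; exact norm_mul_shiftInv_le hδ hh
      _ = δ := by ring
  have hdp : ‖d * p * d‖ ≤ C * δ := by
    have h0 : 0 ≤ d * p * d := by simpa [hds] using star_left_conjugate_nonneg hp d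
    have h1 : d * p * d ≤ C • (d * h * d) := by
      have := star_left_conjugate_le_conjugate hph d
      simpa [hds, mul_smul_comm, smul_mul_assoc] using this
    refine (CStarAlgebra.norm_le_norm_of_nonneg_of_le h0 h1).trans ?_
    rw [norm_smul, Real.norm_of_nonneg hC]
    gcongr
  rw [e1, sq, ← CStarRing.norm_self_mul_star, star_mul, hds]
  have e2 : d * x * (star x * d) = d * p * d + d * (x * star x - p) * d := by noncomm_ring
  rw [e2]
  refine (norm_add_le _ _).trans (add_le_add hdp ?_)
  calc ‖d * (x * star x - p) * d‖ ≤ ‖d‖ * ‖x * star x - p‖ * ‖d‖ :=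
        (norm_mul_le _ _).trans (by gcongr; exact norm_mul_le _ _)
    _ ≤ 1 * η * 1 := by
        have := (norm_nonneg _).trans hx
        gcongr
    _ = η := by ring

/-- The element `q` is `(b + δ)^{-1/2}`. -/
theorem exists_sq_eq_shiftInv {δ : ℝ} (hδ : 0 < δ) {b : B} (hb : 0 ≤ b) :
    ∃ q : B, star q = q ∧ q * b * q = b * shiftInv δ b := by
  have hc : ContinuousOn (fun t : ℝ => √((t + δ)⁻¹)) (spectrum ℝ b) :=
    (continuousOn_spectrum_of_nonneg (continuousOn_inv_add hδ) hb).sqrt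
  refine ⟨cfc (fun t : ℝ => √((t + δ)⁻¹)) b, (cfc_predicate _ b : IsSelfAdjoint _).star_eq, ?_⟩
  have hcomm : Commute (cfc (fun t : ℝ => √((t + δ)⁻¹)) b) b := by
    have := cfc_commute_cfc (fun t : ℝ => √((t + δ)⁻¹)) (fun t : ℝ => t) b
    rwa [cfc_id' ℝ b] at this
  rw [hcomm.eq, mul_assoc, ← cfc_mul _ _ b hc hc, shiftInv]
  congr 1
  refine cfc_congr fun t ht => ?_
  have := spectrum_nonneg_of_nonneg hb ht
  exact Real.mul_self_sqrt (by positivity)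

/-- Domination implies Cuntz subequivalence: with `s = x²`, the element
`x (t + δ)^{-1/2} t (t + δ)^{-1/2} x` tends to `s` as `δ → 0`. -/
theorem mem_closure_conj_of_le {s t : B} (hs : 0 ≤ s) (ht : 0 ≤ t) {C : ℝ} (hC : 0 ≤ C)
    (hst : s ≤ C • t) : s ∈ closure {y : B | ∃ v, y = v * t * star v} := by
  obtain ⟨x, hx, hxx⟩ := exists_isSelfAdjoint_mul_self hs
  rw [Metric.mem_closure_iff]
  intro ε hε
  obtain ⟨η, hη, hηε⟩ : ∃ η : ℝ, 0 < η ∧ ‖x‖ * η < ε := by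
    refine ⟨ε / (‖x‖ + 1), by positivity, ?_⟩
    rw [mul_div_assoc', div_lt_iff₀ (by positivity)]
    nlinarith [norm_nonneg x]
  obtain ⟨δ, hδ, hδη⟩ : ∃ δ : ℝ, 0 < δ ∧ C * δ + 0 ≤ η ^ 2 := by
    refine ⟨η ^ 2 / (C + 1), by positivity, ?_⟩
    rw [add_zero, mul_div_assoc', div_le_iff₀ (by positivity)]
    nlinarith [sq_nonneg η]
  obtain ⟨q, hq, hqt⟩ := exists_sq_eq_shiftInv hδ ht
  refine ⟨x * q * t * star (x * q), ⟨_, rfl⟩, ?_⟩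
  have key := norm_sub_mul_shiftInv_sq_le (x := x) hδ ht hs hC hst
    (by rw [hx, hxx, sub_self, norm_zero])
  have key' : ‖x - t * (shiftInv δ t * x)‖ ≤ η := by
    refine le_of_sq_le_sq ?_ hη.le
    exact key.trans hδη
  have e : s - x * q * t * star (x * q) = x * (x - t * (shiftInv δ t * x)) := by
    rw [star_mul, hq, hx, mul_sub, hxx, ← mul_assoc t, ← hqt]
    noncomm_ring
  rw [dist_eq_norm, e]
  exact (norm_mul_le _ _).trans_lt (lt_of_le_of_lt (by gcongr) hηε)

/-- An invertible element has a unitary polar part, which conjugates `g g⋆` to `g⋆ g`. -/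
theorem exists_unitary_conj_of_isUnit {g : B} (hg : IsUnit g) :
    ∃ w : B, star w * w = 1 ∧ w * star w = 1 ∧ w * (g * star g) * star w = star g * g := by
  set s := CFC.sqrt (g * star g) with hsdef
  have hs : star s = s := (IsSelfAdjoint.of_nonneg (CFC.sqrt_nonneg _)).star_eq
  have hss : s * s = g * star g := CFC.sqrt_mul_sqrt_self _ (mul_star_self_nonneg g)
  have hsu : IsUnit s := (CFC.isUnit_sqrt_iff _ (mul_star_self_nonneg g)).2 (hg.mul hg.star)
  obtain ⟨r, hr⟩ := hsu
  obtain ⟨k, hk⟩ := hg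
  set u : Bˣ := r⁻¹ * k with hu
  have hsu : s * (u : B) = g := by rw [hu, ← hr, Units.val_mul, Units.mul_inv_cancel_left, hk]
  have h1 : (u : B) * star (u : B) = 1 := by
    have h2 : s * ((u : B) * star (u : B)) * s = s * 1 * s := by
      calc s * ((u : B) * star (u : B)) * s = s * u * star (s * u) := by
            rw [star_mul, hs]; noncomm_ring
        _ = s * 1 * s := by rw [hsu, mul_one, hss]
    rw [← hr] at h2
    exact r.isUnit.mul_left_cancel (r.isUnit.mul_right_cancel h2)
  have h2 : star (u : B) = ↑u⁻¹ := (Units.inv_eq_of_mul_eq_one_right h1).symm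
  have h3 : star (u : B) * u = 1 := by rw [h2, Units.inv_mul]
  refine ⟨star u, by rw [star_star, h1], by rw [star_star, h3], ?_⟩
  rw [← hss, star_star]
  calc star (u : B) * (s * s) * u = star (s * u) * (s * u) := by
        rw [star_mul, hs]; noncomm_ring
    _ = star g * g := by rw [hsu]

/-- In a C⋆-algebra of stable rank one, if `x x⋆` is close to `z b z⋆` then `b` can be conjugated
by a unitary, and rescaled, so that `x` is close to a right multiple of a square root of the
result, with a contractive multiplier. The unitary is the polar part of an invertible element
approximating `√b z⋆`. -/
theorem exists_conj_near_of_dense_isUnit (hd : Dense {g : B | IsUnit g}) (x : B) {ε : ℝ}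
    (hε : 0 < ε) {b z : B} (hb : 0 ≤ b) (hz : ‖z * b * star z - x * star x‖ < ε ^ 2 / 8) :
    ∃ x' u u' t : B, x' * star x' = u * b * star u ∧ b = u' * (x' * star x') * star u' ∧
      ‖t‖ ≤ 1 ∧ ‖x - x' * t‖ ≤ ε := by
  obtain ⟨r, hr, hrr⟩ := exists_isSelfAdjoint_mul_self hb
  set y := r * star z with hy
  have hη : 0 < ε ^ 2 / 8 := by positivity
  have hyy : star y * y = z * b * star z := by
    rw [hy, star_mul, star_star, hr, ← hrr]; noncomm_ring
  have ho : IsOpen ({g : B | ‖g * star g - y * star y‖ < ε ^ 2 / 8} ∩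
      {g : B | ‖star g * g - star y * y‖ < ε ^ 2 / 8}) :=
    (isOpen_lt (by fun_prop) continuous_const).inter (isOpen_lt (by fun_prop) continuous_const)
  obtain ⟨g, ⟨hg1, hg2⟩, hgu⟩ := hd.inter_open_nonempty _ ho
    ⟨y, by simpa using pow_pos hε 2, by simpa using pow_pos hε 2⟩
  rw [Set.mem_ofPred_eq] at hg1 hg2
  obtain ⟨w, hw1, hw2, hw⟩ := exists_unitary_conj_of_isUnit hgu
  have hwn : ‖w‖ ≤ 1 := norm_le_one_of_star_mul_self_eq_one hw1
  set p := w * (y * star y) * star w with hp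
  set h := w * b * star w with hh
  have hp0 : 0 ≤ p := star_right_conjugate_nonneg (mul_star_self_nonneg y) w
  have hh0 : 0 ≤ h := star_right_conjugate_nonneg hb w
  have hph : p ≤ (‖z‖ ^ 2) • h := by
    have h1 : y * star y ≤ (‖z‖ ^ 2) • b := by
      have := star_right_conjugate_le_conjugate
        (CStarAlgebra.star_mul_le_algebraMap_norm_sq (a := z)) r
      rw [hr, Algebra.algebraMap_eq_smul_one, mul_smul_comm, smul_mul_assoc, mul_one, hrr] at this
      refine le_of_eq_of_le ?_ this
      rw [hy, star_mul, star_star, hr]; noncomm_ring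
    have := star_right_conjugate_le_conjugate h1 w
    rwa [mul_smul_comm, smul_mul_assoc] at this
  have hxp : ‖x * star x - p‖ ≤ 3 * (ε ^ 2 / 8) := by
    have e : x * star x - p = -(z * b * star z - x * star x) - (star g * g - star y * y)
        + w * (g * star g - y * star y) * star w := by
      rw [mul_sub, sub_mul, hw, ← hp, hyy]; abel
    have e3 : ‖w * (g * star g - y * star y) * star w‖ ≤ ε ^ 2 / 8 :=
      calc _ ≤ ‖w‖ * ‖g * star g - y * star y‖ * ‖star w‖ :=
            (norm_mul_le _ _).trans (by gcongr; exact norm_mul_le _ _)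
        _ ≤ 1 * (ε ^ 2 / 8) * 1 := by rw [norm_star]; gcongr
        _ = _ := by ring
    rw [e]
    refine (norm_add_le _ _).trans ?_
    have := (norm_sub_le (-(z * b * star z - x * star x)) (star g * g - star y * y))
    rw [norm_neg] at this
    linarith
  obtain ⟨δ, hδ, hδε⟩ : ∃ δ : ℝ, 0 < δ ∧ ‖z‖ ^ 2 * δ ≤ ε ^ 2 / 2 := by
    refine ⟨ε ^ 2 / 2 / (‖z‖ ^ 2 + 1), by positivity, ?_⟩
    rw [mul_div_assoc', div_le_iff₀ (by positivity)]
    nlinarith [sq_nonneg ε]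
  have key := norm_sub_mul_shiftInv_sq_le hδ hh0 hp0 (by positivity) hph hxp
  set t := r * star w * (shiftInv δ h * x)
  have hc : (1 + ‖t‖) ≠ 0 := by positivity
  refine ⟨(1 + ‖t‖) • (w * r), (1 + ‖t‖) • w, (1 + ‖t‖)⁻¹ • star w, (1 + ‖t‖)⁻¹ • t,
    ?_, ?_, ?_, ?_⟩
  · simp only [star_smul, star_mul, hr, smul_mul_assoc, mul_smul_comm, star_trivial, ← hrr,
      mul_assoc]
  · have : star w * (w * r * (r * star w)) * w = b := by
      calc _ = star w * w * (r * r) * (star w * w) := by noncomm_ring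
        _ = b := by rw [hw1, hrr, one_mul, mul_one]
    simp only [star_smul, star_mul, star_star, hr, smul_mul_assoc, mul_smul_comm, star_trivial,
      smul_smul, this]
    rw [show (1 + ‖t‖)⁻¹ * ((1 + ‖t‖) * (1 + ‖t‖) * (1 + ‖t‖)⁻¹) = 1 by field_simp, one_smul]
  · rw [norm_smul, Real.norm_of_nonneg (by positivity), inv_mul_le_iff₀ (by positivity)]
    linarith
  · rw [smul_mul_smul_comm, mul_inv_cancel₀ hc, one_smul]
    have e : w * r * t = h * (shiftInv δ h * x) := by
      
      simp only [t]
      generalize shiftInv δ h * x = v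
      simp only [hh, ← hrr, mul_assoc]
    rw [e]
    refine le_of_sq_le_sq (key.trans ?_) hε.le
    nlinarith [sq_nonneg ε]

end CStarAlgebra

/-! ### Rectangular matrices and Cuntz subequivalence -/

section Rectangular

variable {A : Type*} [CStarAlgebra A] {k l m n : Type*}

theorem rect_mul_assoc [Fintype l] [Fintype m] (u : CStarMatrix k l A) (v : CStarMatrix l m A)
    (w : CStarMatrix m n A) : u * v * w = u * (v * w) :=
  Matrix.mul_assoc (α := A) u v w

theorem rect_one_mul [Fintype m] [DecidableEq m] (v : CStarMatrix m n A) :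
    (1 : CStarMatrix m m A) * v = v :=
  Matrix.one_mul (α := A) v

theorem rect_mul_one [Fintype n] [DecidableEq n] (v : CStarMatrix m n A) :
    v * (1 : CStarMatrix n n A) = v :=
  Matrix.mul_one (α := A) v

theorem rect_conjTranspose_mul [Fintype l] (u : CStarMatrix k l A) (v : CStarMatrix l m A) :
    (u * v).conjTranspose = v.conjTranspose * u.conjTranspose :=
  Matrix.conjTranspose_mul (α := A) u v

theorem rect_conjTranspose_conjTranspose (u : CStarMatrix k l A) :
    u.conjTranspose.conjTranspose = u :=
  Matrix.conjTranspose_conjTranspose (α := A) u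

theorem conjTranspose_eq_star (u : CStarMatrix k k A) : u.conjTranspose = star u := rfl

theorem rect_sum_apply {ι : Type*} (s : Finset ι) (f : ι → CStarMatrix m n A) (i : m) (j : n) :
    (∑ x ∈ s, f x) i j = ∑ x ∈ s, f x i j :=
  Matrix.sum_apply (α := A) i j s f

theorem conj_conj [Fintype m] [Fintype n] (u : CStarMatrix l m A) (v : CStarMatrix m n A)
    (b : CStarMatrix n n A) :
    u * (v * b * v.conjTranspose) * u.conjTranspose = (u * v) * b * (u * v).conjTranspose := by
  simp only [rect_conjTranspose_mul, rect_mul_assoc]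

variable (m) in
/-- The elements `v b v⋆`, for `v` a rectangular matrix. The rows of `v` may be indexed by another
type than those of `b`, which replaces padding by zeros. -/
def conjSet [Fintype n] (b : CStarMatrix n n A) : Set (CStarMatrix m m A) :=
  {x | ∃ v : CStarMatrix m n A, x = v * b * v.conjTranspose}

theorem conj_mem_conjSet [Fintype n] (v : CStarMatrix m n A) (b : CStarMatrix n n A) :
    v * b * v.conjTranspose ∈ conjSet m b := ⟨v, rfl⟩

theorem conj_mem_conjSet_of_mem [Fintype m] [Fintype n] (u : CStarMatrix l m A)
    {x : CStarMatrix m m A} {b : CStarMatrix n n A} (hx : x ∈ conjSet m b) :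
    u * x * u.conjTranspose ∈ conjSet l b := by
  obtain ⟨v, rfl⟩ := hx
  exact ⟨u * v, conj_conj u v b⟩

theorem continuous_conj [Fintype n] (v : CStarMatrix m n A) :
    Continuous fun b : CStarMatrix n n A => v * b * v.conjTranspose :=
  Continuous.matrix_mul (R := A) (A := fun b : CStarMatrix n n A => v * b)
    (B := fun _ => v.conjTranspose)
    (Continuous.matrix_mul (R := A) (A := fun _ => v) (B := id) continuous_const continuous_id)
    continuous_const

/-- Transitivity of approximate conjugation, for a general family `T` of targets; it is applied both
to a single `conjSet` and to the union of the `conjSet`s of a sequence. -/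
theorem mem_closure_of_mem_closure_conjSet [Fintype n]
    {T : Set (CStarMatrix n n A)} {T' : Set (CStarMatrix m m A)}
    (hT : ∀ x ∈ T, ∀ v : CStarMatrix m n A, v * x * v.conjTranspose ∈ T')
    {a : CStarMatrix n n A} (ha : a ∈ closure T) {x : CStarMatrix m m A}
    (hx : x ∈ closure (conjSet m a)) : x ∈ closure T' := by
  refine closure_minimal ?_ isClosed_closure hx
  rintro _ ⟨v, rfl⟩
  exact map_mem_closure (f := fun y => v * y * v.conjTranspose) (continuous_conj v) ha
    fun y hy => hT y hy v

theorem mem_closure_conjSet_trans [Fintype m] [Fintype n]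
    {x : CStarMatrix l l A} {a : CStarMatrix m m A} {b : CStarMatrix n n A}
    (hx : x ∈ closure (conjSet l a)) (ha : a ∈ closure (conjSet m b)) :
    x ∈ closure (conjSet l b) :=
  mem_closure_of_mem_closure_conjSet (fun _ hy v => conj_mem_conjSet_of_mem v hy) ha hx

variable [Fintype n] [PartialOrder A] [StarOrderedRing A]

theorem mem_closure_conjSet_of_le [DecidableEq n] {s t : CStarMatrix n n A} (hs : 0 ≤ s)
    (ht : 0 ≤ t) {C : ℝ} (hC : 0 ≤ C) (hst : s ≤ C • t) : s ∈ closure (conjSet n t) :=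
  mem_closure_conj_of_le hs ht hC hst

/-- With `y = v √b`. -/
theorem exists_conj_eq_mul_conjTranspose [DecidableEq n] (v : CStarMatrix m n A)
    {b : CStarMatrix n n A} (hb : 0 ≤ b) :
    ∃ y : CStarMatrix m n A, v * b * v.conjTranspose = y * y.conjTranspose := by
  obtain ⟨r, hr, rfl⟩ := exists_isSelfAdjoint_mul_self hb
  refine ⟨v * r, ?_⟩
  rw [rect_conjTranspose_mul, conjTranspose_eq_star, hr]
  simp only [rect_mul_assoc]

variable [Fintype m]

/-- The matrix `v v⋆` is positive for every rectangular `v`: it is the sum over the columns of `v`,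
and a single column can be completed by zeros to a square matrix. -/
theorem rect_mul_conjTranspose_nonneg [DecidableEq m] (v : CStarMatrix m n A) :
    0 ≤ v * v.conjTranspose := by
  rcases isEmpty_or_nonempty m with hm | ⟨⟨i₀⟩⟩
  · exact le_of_eq (by ext i; exact hm.elim i)
  · let c : n → CStarMatrix m m A := fun j =>
      CStarMatrix.ofMatrix fun i k => if k = i₀ then v i j else 0
    have c_apply : ∀ j i k, c j i k = if k = i₀ then v i j else 0 := fun _ _ _ => rfl
    have : v * v.conjTranspose = ∑ j, c j * star (c j) := by
      ext i i'
      simp [CStarMatrix.mul_apply, CStarMatrix.star_apply, rect_sum_apply, c_apply]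
    rw [this]
    exact Finset.sum_nonneg fun j _ => mul_star_self_nonneg (c j)

theorem conj_nonneg [DecidableEq m] [DecidableEq n] (v : CStarMatrix m n A)
    {b : CStarMatrix n n A} (hb : 0 ≤ b) : 0 ≤ v * b * v.conjTranspose := by
  obtain ⟨y, hy⟩ := exists_conj_eq_mul_conjTranspose v hb
  exact hy ▸ rect_mul_conjTranspose_nonneg y

/-- The bound `|t³ / (t + δ)² - t| ≤ 2 δ` for `t ≥ 0`, at the level of elements. -/
theorem norm_sub_mul_shiftInv_cube_le {B : Type*} [CStarAlgebra B] [PartialOrder B]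
    [StarOrderedRing B] {δ : ℝ} (hδ : 0 < δ) {a : B} (ha : 0 ≤ a) :
    ‖a * (shiftInv δ a * a * shiftInv δ a) * a - a‖ ≤ 2 * δ := by
  set e := a * shiftInv δ a with he
  have hc := (commute_shiftInv δ ha).eq
  have h1 : a * (shiftInv δ a * a * shiftInv δ a) * a - a = -(δ • e + δ • e * e) := by
    have h2 : δ • shiftInv δ a = 1 - e := eq_sub_of_add_eq' (mul_shiftInv_add hδ ha)
    have h3 : δ • e = a - a * e := by
      rw [he, ← mul_smul_comm, h2, mul_sub, mul_one]
    have h4 : Commute e a := by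
      rw [he]; exact (Commute.refl a).mul_left (commute_shiftInv δ ha)
    have h5 : a * (shiftInv δ a * a * shiftInv δ a) * a = a * e * e := by
      rw [mul_assoc, mul_assoc (shiftInv δ a * a), hc, he]
      noncomm_ring
    rw [h5, h3, sub_mul]
    abel
  have he1 : ‖e‖ ≤ 1 := norm_mul_shiftInv_le hδ ha
  rw [h1, norm_neg, smul_mul_assoc, ← smul_add, norm_smul, Real.norm_of_nonneg hδ.le]
  have h6 : ‖e + e * e‖ ≤ 2 := by
    refine (norm_add_le _ _).trans ?_
    have := norm_mul_le e e
    nlinarith [norm_nonneg e]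
  nlinarith

/-- If a positive `a` is a limit of conjugates of `c`, then `a` is a limit of conjugates of positive
matrices `b` that have the size of `c` and are themselves conjugates of `a`. With `a ≈ y y⋆`,
such a `b` is `y⋆ g y` for a suitable function `g` of `a`. -/
theorem mem_closure_conj_of_mem_closure_conjSet [DecidableEq m] [DecidableEq n]
    {a : CStarMatrix m m A} {c : CStarMatrix n n A} (ha : 0 ≤ a) (hc : 0 ≤ c)
    (hac : a ∈ closure (conjSet m c)) :
    a ∈ closure {x : CStarMatrix m m A |
      ∃ b : CStarMatrix n n A, 0 ≤ b ∧ b ∈ conjSet n a ∧ x ∈ conjSet m b} := by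
  set S := {x : CStarMatrix m m A |
      ∃ b : CStarMatrix n n A, 0 ≤ b ∧ b ∈ conjSet n a ∧ x ∈ conjSet m b} with hS
  have h1 : ∀ δ : ℝ, 0 < δ → a * (shiftInv δ a * a * shiftInv δ a) * a ∈ closure S := by
    intro δ hδ
    have hr : star (shiftInv δ a) = shiftInv δ a :=
      (IsSelfAdjoint.of_nonneg (shiftInv_nonneg hδ ha)).star_eq
    refine map_mem_closure (f := fun y => y * (shiftInv δ a * a * shiftInv δ a) * y)
      (by fun_prop) hac ?_
    rintro _ ⟨v, rfl⟩
    obtain ⟨y, hy⟩ := exists_conj_eq_mul_conjTranspose v hc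
    have hb : y.conjTranspose * (shiftInv δ a * a * shiftInv δ a) * y
        = (y.conjTranspose * shiftInv δ a) * a *
          (y.conjTranspose * shiftInv δ a).conjTranspose := by
      rw [rect_conjTranspose_mul, conjTranspose_eq_star, hr, rect_conjTranspose_conjTranspose]
      simp only [rect_mul_assoc]
    refine ⟨y.conjTranspose * (shiftInv δ a * a * shiftInv δ a) * y, ?_, ?_, y, ?_⟩
    · rw [hb]; exact conj_nonneg _ ha
    · rw [hb]; exact conj_mem_conjSet _ _
    · simp only [hy, rect_mul_assoc]
  have h2 : Tendsto (fun k : ℕ => a * (shiftInv (1 / ((k : ℝ) + 1)) a * a *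
      shiftInv (1 / ((k : ℝ) + 1)) a) * a) atTop (𝓝 a) := by
    rw [tendsto_iff_norm_sub_tendsto_zero]
    refine squeeze_zero (fun _ => norm_nonneg _)
      (fun k => norm_sub_mul_shiftInv_cube_le (by positivity) ha) ?_
    simpa using (tendsto_one_div_add_atTop_nhds_zero_nat (𝕜 := ℝ)).const_mul 2
  exact isClosed_closure.mem_of_tendsto h2 (Eventually.of_forall fun k => h1 _ (by positivity))

end Rectangular

section Subequiv

variable {A : Type*} [CStarAlgebra A]

variable (A) in
/-- The isometry from `A^m` onto the first `m` coordinates of `A^n`, for `m ≤ n`. -/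
def padIso (m n : ℕ) : CStarMatrix (Fin n) (Fin m) A :=
  CStarMatrix.ofMatrix fun i j => if i.1 = j.1 then 1 else 0

theorem padIso_apply (m n : ℕ) (i : Fin n) (j : Fin m) :
    padIso A m n i j = if i.1 = j.1 then 1 else 0 := rfl

theorem padIso_conjTranspose_mul_self {m n : ℕ} (h : m ≤ n) :
    (padIso A m n).conjTranspose * padIso A m n = (1 : CStarMatrix (Fin m) (Fin m) A) := by
  ext i j
  rw [CStarMatrix.mul_apply, Finset.sum_eq_single (Fin.castLE h i)]
  · simp [padIso_apply, CStarMatrix.one_apply, Fin.ext_iff]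
  · intro k _ hk
    have : k.1 ≠ i.1 := fun h' => hk (by ext; simp [h'])
    simp [padIso_apply, this]
  · simp

theorem pad_eq_conj {m n : ℕ} (h : m ≤ n) (a : CStarMatrix (Fin m) (Fin m) A) :
    pad h a = padIso A m n * a * (padIso A m n).conjTranspose := by
  have key : ∀ (i : Fin n) (f : Fin m → A),
      ∑ j, padIso A m n i j * f j = if hi : i.1 < m then f ⟨i.1, hi⟩ else 0 := by
    intro i f
    by_cases hi : i.1 < m
    · rw [dif_pos hi, Finset.sum_eq_single ⟨i.1, hi⟩]
      · simp [padIso_apply]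
      · intro j _ hj
        have : i.1 ≠ j.1 := fun h' => hj (by ext; simp [h'])
        simp [padIso_apply, this]
      · simp
    · rw [dif_neg hi]
      refine Finset.sum_eq_zero fun j _ => ?_
      have : i.1 ≠ j.1 := fun h' => hi (h' ▸ j.2)
      simp [padIso_apply, this]
  ext i j
  have h1 : ∀ (i : Fin m) (j : Fin n), (a * (padIso A m n).conjTranspose) i j =
      if hj : j.1 < m then a i ⟨j.1, hj⟩ else 0 := by
    intro i j
    rw [CStarMatrix.mul_apply, ← star_star (∑ x, _), star_sum]
    simp_rw [star_mul, CStarMatrix.conjTranspose_apply, star_star]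
    rw [key]
    split_ifs <;> simp
  rw [rect_mul_assoc, CStarMatrix.mul_apply, key, pad_apply]
  by_cases hi : i.1 < m <;> by_cases hj : j.1 < m <;> simp [hi, hj, h1]

variable [PartialOrder A] [StarOrderedRing A]

/-- Cuntz subequivalence in terms of rectangular matrices. -/
theorem subequiv_iff_mem_closure (a b : PosMat A) :
    Subequiv a b ↔ a.mat ∈ closure (conjSet (Fin a.size) b.mat) := by
  rw [subequiv_iff, Metric.mem_closure_iff]
  refine forall₂_congr fun ε hε => ⟨?_, ?_⟩
  · rintro ⟨N, ha, hb, v, hv⟩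
    refine ⟨_, conj_mem_conjSet
      ((padIso A a.size N).conjTranspose * (v * padIso A b.size N)) b.mat, ?_⟩
    set x := (padIso A a.size N).conjTranspose * (v * padIso A b.size N) * b.mat *
      ((padIso A a.size N).conjTranspose * (v * padIso A b.size N)).conjTranspose with hx
    have e : pad ha (x - a.mat) =
        pad ha 1 * (v * pad hb b.mat * star v - pad ha a.mat) * pad ha 1 := by
      have h1 : pad ha 1 * pad ha a.mat * pad ha 1 = pad ha a.mat := by
        simp only [← map_mul, one_mul, mul_one]
      rw [mul_sub, sub_mul, h1, map_sub]
      congr 1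
      have h2 : pad ha (1 : CStarMatrix (Fin a.size) (Fin a.size) A)
          = padIso A a.size N * (padIso A a.size N).conjTranspose := by
        rw [pad_eq_conj, rect_mul_one]
      rw [h2, pad_eq_conj, pad_eq_conj, hx]
      simp only [rect_conjTranspose_mul, rect_mul_assoc, rect_conjTranspose_conjTranspose,
        conjTranspose_eq_star]
    have h1 : ‖pad ha (1 : CStarMatrix (Fin a.size) (Fin a.size) A)‖ ≤ 1 := by
      rw [norm_pad]
      exact norm_le_one_of_star_mul_self_eq_one (by simp)
    rw [dist_comm, dist_eq_norm, ← norm_pad ha, e]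
    refine lt_of_le_of_lt ?_ hv
    calc _ ≤ ‖pad ha (1 : CStarMatrix (Fin a.size) (Fin a.size) A)‖ *
          ‖v * pad hb b.mat * star v - pad ha a.mat‖ *
          ‖pad ha (1 : CStarMatrix (Fin a.size) (Fin a.size) A)‖ :=
          (norm_mul_le _ _).trans (by gcongr; exact norm_mul_le _ _)
      _ ≤ 1 * ‖v * pad hb b.mat * star v - pad ha a.mat‖ * 1 := by gcongr
      _ = _ := by ring
  · rintro ⟨_, ⟨v, rfl⟩, hv⟩
    obtain ⟨N, ha, hb⟩ : ∃ N, a.size ≤ N ∧ b.size ≤ N :=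
      ⟨_, le_max_left a.size b.size, le_max_right a.size b.size⟩
    refine ⟨_, ha, hb, padIso A a.size N * v * (padIso A b.size N).conjTranspose, ?_⟩
    have e : padIso A a.size N * v * (padIso A b.size N).conjTranspose * pad hb b.mat *
        star (padIso A a.size N * v * (padIso A b.size N).conjTranspose)
        = pad ha (v * b.mat * v.conjTranspose) := by
      rw [← conjTranspose_eq_star, pad_eq_conj, pad_eq_conj]
      calc _ = padIso A a.size N * (v * (((padIso A b.size N).conjTranspose * padIso A b.size N) *
            (b.mat * (((padIso A b.size N).conjTranspose * padIso A b.size N) *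
            (v.conjTranspose * (padIso A a.size N).conjTranspose))))) := by
            simp only [rect_conjTranspose_mul, rect_mul_assoc, rect_conjTranspose_conjTranspose]
        _ = _ := by
            rw [padIso_conjTranspose_mul_self hb]
            simp only [rect_one_mul, rect_mul_assoc]
    rw [e, ← map_sub, norm_pad, ← dist_eq_norm, dist_comm]
    exact hv

end Subequiv

/-! ### Stable rank one passes to matrix algebras -/

section StableRank

variable {R : Type*} [Ring R] {m n : Type*} [Fintype m] [Fintype n] [DecidableEq m] [DecidableEq n]

theorem isUnit_fromBlocks_one_zero_one (S : Matrix n m R) :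
    IsUnit (Matrix.fromBlocks (1 : Matrix m m R) 0 S (1 : Matrix n n R)) := by
  have h : ∀ S : Matrix n m R, Matrix.fromBlocks (1 : Matrix m m R) 0 S (1 : Matrix n n R) *
      Matrix.fromBlocks 1 0 (-S) 1 = 1 := fun S => by simp [Matrix.fromBlocks_multiply]
  exact ⟨⟨_, _, h S, by simpa using h (-S)⟩, rfl⟩

theorem isUnit_fromBlocks_one_one_zero (Q : Matrix m n R) :
    IsUnit (Matrix.fromBlocks (1 : Matrix m m R) Q 0 (1 : Matrix n n R)) := by
  have h : ∀ Q : Matrix m n R, Matrix.fromBlocks (1 : Matrix m m R) Q 0 (1 : Matrix n n R) *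
      Matrix.fromBlocks 1 (-Q) 0 1 = 1 := fun Q => by simp [Matrix.fromBlocks_multiply]
  exact ⟨⟨_, _, h Q, by simpa using h (-Q)⟩, rfl⟩

theorem isUnit_fromBlocks_diagonal {X : Matrix m m R} {T : Matrix n n R} (hX : IsUnit X)
    (hT : IsUnit T) : IsUnit (Matrix.fromBlocks X 0 0 T) := by
  obtain ⟨x, rfl⟩ := hX
  obtain ⟨t, rfl⟩ := hT
  have h : ∀ (x : (Matrix m m R)ˣ) (t : (Matrix n n R)ˣ),
      Matrix.fromBlocks (x : Matrix m m R) 0 0 (t : Matrix n n R) *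
        Matrix.fromBlocks ↑x⁻¹ 0 0 ↑t⁻¹ = 1 := fun x t => by simp [Matrix.fromBlocks_multiply]
  exact ⟨⟨_, _, h x t, by simpa using h x⁻¹ t⁻¹⟩, rfl⟩

variable [TopologicalSpace R] [IsTopologicalRing R]

/-- Perturb the lower right block to make it invertible, then perturb the upper left block to make
the Schur complement invertible. -/
theorem dense_isUnit_matrix_sum (hm : Dense {x : Matrix m m R | IsUnit x})
    (hn : Dense {x : Matrix n n R | IsUnit x}) :
    Dense {x : Matrix (m ⊕ n) (m ⊕ n) R | IsUnit x} := by
  rw [dense_iff_inter_open]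
  rintro U hU ⟨M, hM⟩
  obtain ⟨P, Q, S, T, rfl⟩ : ∃ P Q S T, M = Matrix.fromBlocks P Q S T :=
    ⟨_, _, _, _, M.fromBlocks_toBlocks.symm⟩
  obtain ⟨_, hT, ⟨t, rfl⟩⟩ := hn.inter_open_nonempty
    ((fun T : Matrix n n R => Matrix.fromBlocks P Q S T) ⁻¹' U)
    (hU.preimage (Continuous.matrix_fromBlocks continuous_const continuous_const continuous_const
      continuous_id)) ⟨T, hM⟩
  set K := Q * (↑t⁻¹ : Matrix n n R) * S
  obtain ⟨X, hXU, hX⟩ := hm.inter_open_nonempty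
    ((fun X : Matrix m m R => Matrix.fromBlocks (X + K) Q S (t : Matrix n n R)) ⁻¹' U)
    (hU.preimage (Continuous.matrix_fromBlocks (continuous_id.add continuous_const)
      continuous_const continuous_const continuous_const))
    ⟨P - K, by simpa using hT⟩
  refine ⟨_, hXU, ?_⟩
  have e : Matrix.fromBlocks (X + K) Q S (t : Matrix n n R) =
      Matrix.fromBlocks 1 (Q * (↑t⁻¹ : Matrix n n R)) 0 1 * Matrix.fromBlocks X 0 0 t *
        Matrix.fromBlocks 1 0 ((↑t⁻¹ : Matrix n n R) * S) 1 := by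
    simp [Matrix.fromBlocks_multiply, Matrix.mul_assoc, K, ← Matrix.mul_assoc (↑t : Matrix n n R)]
  simp only [e]
  exact ((isUnit_fromBlocks_one_one_zero _).mul (isUnit_fromBlocks_diagonal hX t.isUnit)).mul
    (isUnit_fromBlocks_one_zero_one _)

theorem dense_isUnit_of_ringEquiv {S T : Type*} [Ring S] [Ring T] [TopologicalSpace S]
    [TopologicalSpace T] (hS : Dense {x : S | IsUnit x}) (e : S ≃+* T) (he : Continuous e) :
    Dense {x : T | IsUnit x} := by
  refine (e.surjective.denseRange.dense_image he hS).mono ?_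
  rintro _ ⟨x, hx, rfl⟩
  exact IsUnit.map e hx

theorem dense_isUnit_matrix_fin (hR : Dense {x : R | IsUnit x}) (n : ℕ) :
    Dense {x : Matrix (Fin n) (Fin n) R | IsUnit x} := by
  induction n with
  | zero => exact fun x => subset_closure (isUnit_of_subsingleton x)
  | succ n ih =>
    have h1 : Dense {x : Matrix (Fin 1) (Fin 1) R | IsUnit x} := by
      refine dense_isUnit_of_ringEquiv hR (Matrix.uniqueRingEquiv (m := Fin 1)).symm ?_
      exact continuous_matrix fun _ _ => continuous_id
    have h2 := dense_isUnit_matrix_sum ih h1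
    have h3 : Continuous (Matrix.reindexRingEquiv R (finSumFinEquiv (m := n) (n := 1))) :=
      continuous_matrix fun i j => continuous_id.matrix_elem _ _
    exact dense_isUnit_of_ringEquiv h2 _ h3

theorem dense_isUnit_cstarMatrix_fin {A : Type*} [CStarAlgebra A] [PartialOrder A]
    [StarOrderedRing A] (hA : Dense {x : A | IsUnit x}) (n : ℕ) :
    Dense {x : CStarMatrix (Fin n) (Fin n) A | IsUnit x} :=
  dense_isUnit_of_ringEquiv (dense_isUnit_matrix_fin hA n) CStarMatrix.ofMatrixRingEquiv
    continuous_id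

end StableRank

/-! ### The supremum of a bounded increasing sequence -/

section Supremum

theorem exists_seq_of_forall_exists {α : Type*} {P : ℕ → α → Prop} {R : ℕ → α → α → Prop}
    (h0 : ∃ x, P 0 x) (h : ∀ n x, P n x → ∃ y, P (n + 1) y ∧ R n x y) :
    ∃ f : ℕ → α, ∀ n, P n (f n) ∧ R n (f n) (f (n + 1)) := by
  obtain ⟨x₀, hx₀⟩ := h0
  choose g hg using h
  let F : ∀ n, {x // P n x} :=
    fun n => Nat.rec ⟨x₀, hx₀⟩ (fun n x => ⟨g n x.1 x.2, (hg n x.1 x.2).1⟩) n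
  exact ⟨fun n => (F n).1, fun n => ⟨(F n).2, (hg n (F n).1 (F n).2).2⟩⟩

theorem mul_mul_star_le_of_norm_le_one {B : Type*} [CStarAlgebra B] [PartialOrder B]
    [StarOrderedRing B] (y : B) {t : B} (ht : ‖t‖ ≤ 1) :
    y * t * star (y * t) ≤ y * star y := by
  have h1 : t * star t ≤ 1 := by
    rw [← CStarAlgebra.norm_le_one_iff_of_nonneg _ (mul_star_self_nonneg t),
      CStarRing.norm_self_mul_star]
    exact mul_le_one₀ ht (norm_nonneg _) ht
  have h2 := star_right_conjugate_le_conjugate h1 y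
  rw [mul_one] at h2
  simpa only [star_mul, mul_assoc] using h2

/-- A sequence `x m` in a C⋆-algebra that increases up to small errors, in the sense that
`x m` is close to `x (m + 1) * t m` with `t m` a contraction, has a small perturbation `y m` for
which this holds without errors. Here `y m` is the limit of `x (m + j) * (t (m + j - 1) ⋯ t m)`. -/
theorem exists_limit_of_approx_mul {B : Type*} [CStarAlgebra B] [PartialOrder B]
    [StarOrderedRing B] {x t : ℕ → B} {δ : ℕ → ℝ}
    (ht : ∀ m, ‖t m‖ ≤ 1) (hδ : ∀ m, δ (m + 1) ≤ δ m / 2)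
    (hx : ∀ m, ‖x m - x (m + 1) * t m‖ ≤ δ m) :
    ∃ y : ℕ → B, (∀ m, y m ∈ Metric.closedBall (x m) (2 * δ m)) ∧ (∀ m, y m = y (m + 1) * t m) ∧
      ∀ m, y m * star (y m) ∈ closure {p | 0 ≤ p ∧ ∃ j, p ≤ x j * star (x j)} := by
  -- `Y j m = x (m + j) * (t (m + j - 1) ⋯ t m)`
  let Y : ℕ → ℕ → B := fun j => Nat.rec x (fun _ z m => z (m + 1) * t m) j
  have hY0 : ∀ m, Y 0 m = x m := fun _ => rfl
  have hYs : ∀ j m, Y (j + 1) m = Y j (m + 1) * t m := fun _ _ => rfl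
  have hδj : ∀ j m, δ (m + j) ≤ δ m / 2 ^ j := by
    intro j m
    induction j with
    | zero => simp
    | succ j ih =>
      refine (hδ (m + j)).trans ?_
      rw [pow_succ, ← div_div]
      gcongr
  have hdist : ∀ j m, dist (Y j m) (Y (j + 1) m) ≤ δ (m + j) := by
    intro j
    induction j with
    | zero => intro m; rw [dist_eq_norm]; exact hx m
    | succ j ih =>
      intro m
      rw [hYs j, hYs (j + 1), dist_eq_norm, ← sub_mul, show m + (j + 1) = m + 1 + j by omega]
      have := ih (m + 1)
      rw [dist_eq_norm] at this
      calc _ ≤ ‖Y j (m + 1) - Y (j + 1) (m + 1)‖ * ‖t m‖ := norm_mul_le _ _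
        _ ≤ ‖Y j (m + 1) - Y (j + 1) (m + 1)‖ * 1 := by gcongr; exact ht m
        _ ≤ _ := by rwa [mul_one]
  have hdist' : ∀ m j, dist (Y j m) (Y (j + 1) m) ≤ 2 * δ m / 2 / 2 ^ j := fun m j => by
    rw [mul_div_cancel_left₀ _ two_ne_zero]
    exact (hdist j m).trans (hδj j m)
  have hc : ∀ m, ∃ y, Tendsto (fun j => Y j m) atTop (𝓝 y) := fun m =>
    cauchySeq_tendsto_of_complete (cauchySeq_of_le_geometric_two (hdist' m))
  choose y hy using hc
  refine ⟨y, fun m => ?_, fun m => ?_, fun m => ?_⟩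
  · rw [Metric.mem_closedBall, dist_comm]
    exact dist_le_of_le_geometric_two_of_tendsto₀ (hdist' m) (hy m)
  · exact tendsto_nhds_unique ((tendsto_add_atTop_iff_nat 1).2 (hy m))
      ((hy (m + 1)).mul_const (t m))
  · have hle : ∀ j m, Y j m * star (Y j m) ≤ x (m + j) * star (x (m + j)) := by
      intro j
      induction j with
      | zero => intro m; exact le_rfl
      | succ j ih =>
        intro m
        rw [hYs, show m + (j + 1) = m + 1 + j by omega]
        exact (mul_mul_star_le_of_norm_le_one _ (ht m)).trans (ih (m + 1))
    exact mem_closure_of_tendsto ((hy m).mul (hy m).star)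
      (Eventually.of_forall fun j => ⟨mul_star_self_nonneg _, _, hle j m⟩)

/-- A weighted sum of an increasing sequence of positive elements dominates a multiple of each of
them, and its partial sums are dominated by members of the sequence. -/
theorem exists_dominating_of_monotone {B : Type*} [CStarAlgebra B] [PartialOrder B]
    [StarOrderedRing B] {h : ℕ → B} (hh0 : ∀ m, 0 ≤ h m) (hhm : Monotone h) :
    ∃ S : B, 0 ≤ S ∧ (∀ m, ∃ C : ℝ, 0 ≤ C ∧ h m ≤ C • S) ∧
      S ∈ closure {p | 0 ≤ p ∧ ∃ M, p ≤ h M} := by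
  set r : ℕ → ℝ := fun m => (1 / 2) ^ (m + 1) / (1 + ‖h m‖) with hr
  have hr0 : ∀ m, 0 < r m := fun m => by positivity
  have hr1 : ∀ m, ‖r m • h m‖ ≤ (1 / 2) ^ (m + 1) := fun m => by
    rw [norm_smul, Real.norm_of_nonneg (hr0 m).le, hr, div_mul_eq_mul_div,
      div_le_iff₀ (by positivity)]
    gcongr
    linarith
  have hr2 : ∀ m, r m ≤ (1 / 2) ^ (m + 1) := fun m =>
    div_le_self (by positivity) (by linarith [norm_nonneg (h m)])
  have hg : HasSum (fun m : ℕ => (1 / 2 : ℝ) ^ (m + 1)) 1 := by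
    have := hasSum_geometric_two.mul_left (1 / 2 : ℝ)
    simpa [pow_succ'] using this
  have hsum : Summable fun m => r m • h m := .of_norm_bounded hg.summable hr1
  have hterm0 : ∀ m, 0 ≤ r m • h m := fun m => smul_nonneg (hr0 m).le (hh0 m)
  refine ⟨∑' m, r m • h m, tsum_nonneg hterm0, fun m => ⟨(r m)⁻¹, (inv_pos.2 (hr0 m)).le, ?_⟩, ?_⟩
  · have := smul_le_smul_of_nonneg_left (hsum.le_tsum m fun j _ => hterm0 j)
      (inv_nonneg.2 (hr0 m).le)
    rwa [inv_smul_smul₀ (hr0 m).ne'] at this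
  · refine mem_closure_of_tendsto hsum.hasSum.tendsto_sum_nat (Eventually.of_forall fun M =>
      ⟨Finset.sum_nonneg fun m _ => hterm0 m, M, ?_⟩)
    calc ∑ m ∈ Finset.range M, r m • h m ≤ ∑ m ∈ Finset.range M, r m • h M :=
          Finset.sum_le_sum fun m hm =>
            smul_le_smul_of_nonneg_left (hhm (Finset.mem_range.1 hm).le) (hr0 m).le
      _ = (∑ m ∈ Finset.range M, r m) • h M := (Finset.sum_smul).symm
      _ ≤ (1 : ℝ) • h M := by
          refine smul_le_smul_of_nonneg_right ?_ (hh0 M)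
          exact (Finset.sum_le_sum fun m _ => hr2 m).trans
            (sum_le_hasSum _ (fun m _ => by positivity) hg)
      _ = h M := one_smul _ _

variable {A : Type*} [CStarAlgebra A] [PartialOrder A] [StarOrderedRing A]

/-- The matrices `x` for which `x x⋆` is a good lower approximation of each of `a 0, …, a m`. -/
def approxSet (a : ℕ → PosMat A) (k m : ℕ) : Set (CStarMatrix (Fin k) (Fin k) A) :=
  {x | ∀ n ∈ Finset.range (m + 1), ∃ v : CStarMatrix (Fin (a n).size) (Fin k) A,
    ‖v * (x * star x) * v.conjTranspose - (a n).mat‖ < (1 / 2) ^ m}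

theorem isOpen_approxSet (a : ℕ → PosMat A) (k m : ℕ) : IsOpen (approxSet a k m) := by
  have : approxSet a k m = ⋂ n ∈ Finset.range (m + 1),
      ⋃ v : CStarMatrix (Fin (a n).size) (Fin k) A,
        {x | ‖v * (x * star x) * v.conjTranspose - (a n).mat‖ < (1 / 2) ^ m} := by
    ext x; simp [approxSet]
  rw [this]
  refine isOpen_biInter_finset fun n _ => isOpen_iUnion fun v => isOpen_lt ?_ continuous_const
  have h : Continuous fun x : CStarMatrix (Fin k) (Fin k) A => x * star x := by fun_prop
  exact (((continuous_conj v).comp h).sub continuous_const).norm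

/-- One step of the recursion: `x` lies below `a m`, and `x'` lies below `a m`, approximates
`a 0, …, a m`, and has `x` close to its right multiples. -/
theorem exists_approx_step {k : ℕ} (hB : Dense {x : CStarMatrix (Fin k) (Fin k) A | IsUnit x})
    {a : ℕ → PosMat A} {m : ℕ} (ha : ∀ n ≤ m, Subequiv (a n) (a m))
    {c : CStarMatrix (Fin k) (Fin k) A} (hc0 : 0 ≤ c)
    (hc : (a m).mat ∈ closure (conjSet (Fin (a m).size) c))
    {x : CStarMatrix (Fin k) (Fin k) A} (hx : x * star x ∈ closure (conjSet (Fin k) (a m).mat))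
    {ε : ℝ} (hε : 0 < ε) :
    ∃ x' t : CStarMatrix (Fin k) (Fin k) A, x' * star x' ∈ closure (conjSet (Fin k) (a m).mat) ∧
      x' ∈ approxSet a k m ∧ ‖t‖ ≤ 1 ∧ ‖x - x' * t‖ ≤ ε := by
  obtain ⟨_, ⟨z, rfl⟩, hz⟩ := Metric.mem_closure_iff.1 hx (ε ^ 2 / 8) (by positivity)
  have hv : ∀ n ∈ Finset.range (m + 1), ∃ v : CStarMatrix (Fin (a n).size) (Fin (a m).size) A,
      ‖v * (a m).mat * v.conjTranspose - (a n).mat‖ < (1 / 2) ^ m := by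
    intro n hn
    have h1 := (subequiv_iff_mem_closure _ _).1 (ha n (by simpa [Nat.lt_succ_iff] using hn))
    obtain ⟨_, ⟨v, rfl⟩, hv⟩ := Metric.mem_closure_iff.1 h1 ((1 / 2) ^ m) (by positivity)
    exact ⟨v, by rwa [dist_comm, dist_eq_norm] at hv⟩
  choose! v hv using hv
  -- A neighbourhood of `a m` on which the conjugations by `z` and the `v n` stay accurate; it
  -- contains some `u * b * u⋆` with `b` of size `k`.
  set U := {y : CStarMatrix (Fin (a m).size) (Fin (a m).size) A |
      ‖z * y * z.conjTranspose - x * star x‖ < ε ^ 2 / 8} ∩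
    ⋂ n ∈ Finset.range (m + 1), {y | ‖v n * y * (v n).conjTranspose - (a n).mat‖ < (1 / 2) ^ m}
    with hU
  have hUo : IsOpen U := by
    refine (isOpen_lt ((continuous_conj z).sub continuous_const).norm continuous_const).inter ?_
    exact isOpen_biInter_finset fun n _ =>
      isOpen_lt ((continuous_conj (v n)).sub continuous_const).norm continuous_const
  have hUa : (a m).mat ∈ U := by
    refine ⟨?_, Set.mem_iInter₂.2 hv⟩
    rwa [dist_comm, dist_eq_norm] at hz
  obtain ⟨y, ⟨hy1, hy2⟩, b, hb, hba, u, rfl⟩ := mem_closure_iff.1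
    (mem_closure_conj_of_mem_closure_conjSet (a m).nonneg hc0 hc) U hUo hUa
  rw [Set.mem_iInter₂] at hy2
  obtain ⟨x', w, w', t, h1, h2, h3, h4⟩ := exists_conj_near_of_dense_isUnit (z := z * u) hB x hε hb
    (by rw [Set.mem_ofPred_eq, conj_conj] at hy1; exact hy1)
  refine ⟨x', t, ?_, fun n hn => ⟨v n * u * w', ?_⟩, h3, h4⟩
  · rw [h1]; exact subset_closure (conj_mem_conjSet_of_mem w hba)
  · have := hy2 n hn
    rw [Set.mem_ofPred_eq, conj_conj, h2, ← conjTranspose_eq_star w', conj_conj] at this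
    exact this

/-- A bounded increasing sequence of Cuntz classes is realised by an increasing sequence in a matrix
algebra of fixed size. -/
theorem exists_monotone_approx {k : ℕ}
    (hB : Dense {x : CStarMatrix (Fin k) (Fin k) A | IsUnit x})
    {a : ℕ → PosMat A} (ha : ∀ n m, n ≤ m → Subequiv (a n) (a m))
    {c : CStarMatrix (Fin k) (Fin k) A} (hc0 : 0 ≤ c)
    (hc : ∀ m, (a m).mat ∈ closure (conjSet (Fin (a m).size) c)) :
    ∃ h : ℕ → CStarMatrix (Fin k) (Fin k) A, (∀ m, 0 ≤ h m) ∧ Monotone h ∧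
      (∀ m, h m ∈ closure (⋃ n, conjSet (Fin k) (a n).mat)) ∧
      ∀ n, ∀ ε > 0, ∃ m, ∃ v : CStarMatrix (Fin (a n).size) (Fin k) A,
        ‖v * h m * v.conjTranspose - (a n).mat‖ < ε := by
  have step : ∀ m (x : CStarMatrix (Fin k) (Fin k) A) (ε : ℝ),
      x * star x ∈ closure (conjSet (Fin k) (a m).mat) → 0 < ε →
      ∃ p : CStarMatrix (Fin k) (Fin k) A × ℝ,
        (p.1 * star p.1 ∈ closure (conjSet (Fin k) (a m).mat) ∧ 0 < p.2 ∧
          Metric.closedBall p.1 (2 * p.2) ⊆ approxSet a k m) ∧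
        p.2 ≤ ε / 2 ∧ ∃ t : CStarMatrix (Fin k) (Fin k) A, ‖t‖ ≤ 1 ∧ ‖x - p.1 * t‖ ≤ ε := by
    intro m x ε hx hε
    obtain ⟨x', t, h1, h2, h3, h4⟩ :=
      exists_approx_step hB (fun n hn => ha n m hn) hc0 (hc m) hx hε
    obtain ⟨r, hr, hrs⟩ := Metric.isOpen_iff.1 (isOpen_approxSet a k m) x' h2
    refine ⟨(x', min (r / 4) (ε / 2)), ⟨h1, by positivity, ?_⟩, min_le_right _ _, t, h3, h4⟩
    refine (Metric.closedBall_subset_ball ?_).trans hrs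
    have := min_le_left (r / 4) (ε / 2)
    simp only
    linarith
  -- The second component of a state is a tolerance: any perturbation of `p.1` of at most twice that
  -- size still approximates `a 0, …, a m`.
  obtain ⟨f, hf⟩ := exists_seq_of_forall_exists
    (P := fun m (p : CStarMatrix (Fin k) (Fin k) A × ℝ) =>
      p.1 * star p.1 ∈ closure (conjSet (Fin k) (a m).mat) ∧ 0 < p.2 ∧
        Metric.closedBall p.1 (2 * p.2) ⊆ approxSet a k m)
    (R := fun m p q => q.2 ≤ p.2 / 2 ∧
      ∃ t : CStarMatrix (Fin k) (Fin k) A, ‖t‖ ≤ 1 ∧ ‖p.1 - q.1 * t‖ ≤ p.2)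
    (by
      obtain ⟨p, hp, -⟩ := step 0 0 1 (subset_closure ⟨0, by
        rw [zero_mul, CStarMatrix.zero_mul, CStarMatrix.zero_mul]⟩) one_pos
      exact ⟨p, hp⟩)
    (fun m p hp => step (m + 1) p.1 p.2 (mem_closure_conjSet_trans hp.1
      ((subequiv_iff_mem_closure _ _).1 (ha m (m + 1) m.le_succ))) hp.2.1)
  choose hP hδ t ht hx using hf
  obtain ⟨y, hy1, hy2, hy3⟩ := exists_limit_of_approx_mul ht hδ hx
  refine ⟨fun m => y m * star (y m), fun m => mul_star_self_nonneg _,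
    monotone_nat_of_le_succ fun m => ?_, fun m => ?_, fun n ε hε => ?_⟩
  · rw [hy2 m]
    exact mul_mul_star_le_of_norm_le_one _ (ht m)
  · refine closure_minimal ?_ isClosed_closure (hy3 m)
    rintro p ⟨hp, j, hpj⟩
    have h1 := mem_closure_conjSet_of_le hp (mul_star_self_nonneg (f j).1) zero_le_one
      (by rwa [one_smul])
    exact closure_mono (Set.subset_iUnion (fun n => conjSet (Fin k) (a n).mat) j)
      (mem_closure_conjSet_trans h1 (hP j).1)
  · obtain ⟨N, hN⟩ := exists_pow_lt_of_lt_one hε (by norm_num : (1 / 2 : ℝ) < 1)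
    obtain ⟨v, hv⟩ := (hP (max n N)).2.2 (hy1 _) n (by simp)
    refine ⟨_, v, hv.trans (lt_of_le_of_lt ?_ hN)⟩
    exact pow_le_pow_of_le_one (by norm_num) (by norm_num) (le_max_right _ _)

/-- The supremum `s` is a weighted sum of an increasing sequence of representatives. Besides being
an upper bound, it is a limit of conjugates of the members of the sequence. -/
theorem exists_upperBound_mem_closure (hsr : Dense {x : A | IsUnit x}) {a : ℕ → PosMat A}
    (ha : ∀ n m, n ≤ m → Subequiv (a n) (a m)) {c : PosMat A} (hc : ∀ m, Subequiv (a m) c) :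
    ∃ s : PosMat A, (∀ n, Subequiv (a n) s) ∧
      s.mat ∈ closure (⋃ n, conjSet (Fin s.size) (a n).mat) := by
  obtain ⟨h, hh0, hhm, hha, hhn⟩ := exists_monotone_approx
    (dense_isUnit_cstarMatrix_fin hsr c.size) ha c.nonneg
    fun m => (subequiv_iff_mem_closure _ _).1 (hc m)
  obtain ⟨S, hS0, hle, hcl⟩ := exists_dominating_of_monotone hh0 hhm
  refine ⟨⟨c.size, S, hS0⟩, fun n => ?_, ?_⟩
  · rw [subequiv_iff_mem_closure, ← closure_closure]
    refine Metric.mem_closure_iff.2 fun ε hε => ?_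
    obtain ⟨m, v, hv⟩ := hhn n ε hε
    obtain ⟨C, hC, hCS⟩ := hle m
    refine ⟨v * h m * v.conjTranspose, ?_, by rwa [dist_comm, dist_eq_norm]⟩
    exact mem_closure_conjSet_trans (subset_closure (conj_mem_conjSet v (h m)))
      (mem_closure_conjSet_of_le (hh0 m) hS0 hC hCS)
  · refine closure_minimal ?_ isClosed_closure hcl
    rintro p ⟨hp, M, hpM⟩
    have h2 := mem_closure_conjSet_of_le hp (hh0 M) zero_le_one (by rwa [one_smul])
    refine mem_closure_of_mem_closure_conjSet (fun y hy v => ?_) (hha M) h2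
    obtain ⟨n, hn⟩ := Set.mem_iUnion.1 hy
    exact Set.mem_iUnion.2 ⟨n, conj_mem_conjSet_of_mem v hn⟩

/-- An upper bound that is a limit of conjugates of the members is the least upper bound. -/
theorem isLUB_of_mem_closure {a : ℕ → PosMat A} {s : PosMat A} (hs : ∀ n, Subequiv (a n) s)
    (hcl : s.mat ∈ closure (⋃ n, conjSet (Fin s.size) (a n).mat)) :
    IsLUB (Set.range fun n => cls (a n)) (cls s) := by
  refine ⟨?_, fun x hx => ?_⟩
  · rintro _ ⟨n, rfl⟩
    exact hs n
  · induction x using Quotient.inductionOn with | _ b => ?_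
    have hb : ∀ n, Subequiv (a n) b := fun n => hx ⟨n, rfl⟩
    refine (subequiv_iff_mem_closure s b).2 ?_
    refine closure_minimal ?_ isClosed_closure hcl
    refine Set.iUnion_subset fun n y hy => ?_
    exact mem_closure_conjSet_trans (subset_closure hy) ((subequiv_iff_mem_closure _ _).1 (hb n))

end Supremum

/-! ### Dimension functions through resolvents -/

section ResolventTrace

variable {B : Type*} [CStarAlgebra B] [PartialOrder B] [StarOrderedRing B]

theorem mul_shiftInv_eq_one_sub {δ : ℝ} (hδ : 0 < δ) {b : B} (hb : 0 ≤ b) :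
    b * shiftInv δ b = 1 - δ • shiftInv δ b :=
  eq_sub_of_add_eq (mul_shiftInv_add hδ hb)

theorem shiftInv_eq_ringInverse {δ : ℝ} (hδ : 0 < δ) {b : B} (hb : 0 ≤ b) :
    shiftInv δ b = Ring.inverse (b + algebraMap ℝ B δ) := by
  have h1 : (b + algebraMap ℝ B δ) * shiftInv δ b = 1 := by
    rw [add_mul, ← Algebra.smul_def, mul_shiftInv_add hδ hb]
  have h2 : shiftInv δ b * (b + algebraMap ℝ B δ) = 1 := by
    rw [mul_add, ← Algebra.commutes, ← Algebra.smul_def, shiftInv_mul_add hδ hb]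
  exact (Ring.inverse_unit (⟨_, _, h1, h2⟩ : Bˣ)).symm

theorem shiftInv_antitone {δ : ℝ} (hδ : 0 < δ) {a b : B} (ha : 0 ≤ a) (hab : a ≤ b) :
    shiftInv δ b ≤ shiftInv δ a := by
  rw [shiftInv_eq_ringInverse hδ ha, shiftInv_eq_ringInverse hδ (ha.trans hab)]
  refine CStarAlgebra.ringInverse_le_ringInverse (by gcongr) ?_
  exact IsStrictlyPositive.nonneg_add ha (isStrictlyPositive_algebraMap hδ)

theorem shiftInv_smul {δ C : ℝ} (hδ : 0 < δ) (hC : 0 < C) {b : B} (hb : 0 ≤ b) :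
    shiftInv δ (C • b) = C⁻¹ • shiftInv (δ / C) b := by
  have h1 := shiftInv_mul_add hδ (smul_nonneg hC.le hb)
  have h2 := mul_shiftInv_add (div_pos hδ hC) hb
  have h3 : (C • b) * (C⁻¹ • shiftInv (δ / C) b) + δ • (C⁻¹ • shiftInv (δ / C) b) = 1 := by
    rw [smul_mul_smul_comm, mul_inv_cancel₀ hC.ne', one_smul, smul_smul, ← div_eq_mul_inv, h2]
  generalize C⁻¹ • shiftInv (δ / C) b = r at *
  generalize shiftInv δ (C • b) = s at *
  calc s = s * ((C • b) * r + δ • r) := by rw [h3, mul_one]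
    _ = (s * (C • b) + δ • s) * r := by
        rw [mul_add, add_mul, mul_assoc, mul_smul_comm δ, smul_mul_assoc δ]
    _ = r := by rw [h1, one_mul]

/-- The function `b ↦ b (b + δ)⁻¹` is operator monotone. -/
theorem mul_shiftInv_le_of_le_smul {δ C : ℝ} (hδ : 0 < δ) (hC : 0 < C) {a b : B} (ha : 0 ≤ a)
    (hb : 0 ≤ b) (hab : a ≤ C • b) :
    a * shiftInv δ a ≤ b * shiftInv (δ / C) b := by
  rw [mul_shiftInv_eq_one_sub hδ ha, mul_shiftInv_eq_one_sub (div_pos hδ hC) hb,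
    show (δ / C) • shiftInv (δ / C) b = δ • shiftInv δ (C • b) by
      rw [shiftInv_smul hδ hC hb, smul_smul, div_eq_mul_inv]]
  gcongr
  exact shiftInv_antitone hδ ha hab

/-- The function `b ↦ b (b + δ)⁻¹` is Lipschitz, by the resolvent identity. -/
theorem norm_mul_shiftInv_sub_le {δ : ℝ} (hδ : 0 < δ) {a b : B} (ha : 0 ≤ a) (hb : 0 ≤ b) :
    ‖a * shiftInv δ a - b * shiftInv δ b‖ ≤ ‖a - b‖ / δ := by
  have e : a * shiftInv δ a - b * shiftInv δ b
      = δ⁻¹ • ((δ • shiftInv δ b) * (a - b) * (δ • shiftInv δ a)) := by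
    have h1 := mul_shiftInv_eq_one_sub hδ ha
    have h2 := eq_sub_of_add_eq (shiftInv_mul_add hδ hb)
    have h3 : (δ • shiftInv δ b) * (a - b) * (δ • shiftInv δ a)
        = δ • ((δ • shiftInv δ b) * (a * shiftInv δ a) -
            (shiftInv δ b * b) * (δ • shiftInv δ a)) := by
      simp only [smul_mul_assoc, mul_smul_comm, mul_sub, sub_mul, smul_sub, mul_assoc]
    rw [h3, inv_smul_smul₀ hδ.ne', h1, h2, mul_shiftInv_eq_one_sub hδ hb, mul_sub, sub_mul,
      one_mul, mul_one]
    abel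
  rw [e, norm_smul, Real.norm_of_nonneg (by positivity), inv_mul_eq_div]
  gcongr
  calc _ ≤ ‖δ • shiftInv δ b‖ * ‖a - b‖ * ‖δ • shiftInv δ a‖ :=
        (norm_mul_le _ _).trans (by gcongr; exact norm_mul_le _ _)
    _ ≤ 1 * ‖a - b‖ * 1 := by
        gcongr
        · exact norm_smul_shiftInv_le hδ hb
        · exact norm_smul_shiftInv_le hδ ha
    _ = _ := by ring

theorem mul_mul_le_norm_smul {r V : B} (hr : star r = r) (hV : 0 ≤ V) :
    r * V * r ≤ ‖V‖ • (r * r) := by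
  have := star_right_conjugate_le_conjugate
    (IsSelfAdjoint.le_algebraMap_norm_self (IsSelfAdjoint.of_nonneg hV)) r
  rwa [hr, Algebra.algebraMap_eq_smul_one, mul_smul_comm, smul_mul_assoc, mul_one] at this

theorem monotone_of_nonneg_map (φ : B →ₗ[ℝ] ℝ) (hφ : ∀ x : B, 0 ≤ x → 0 ≤ φ x) : Monotone φ := by
  intro x y hxy
  have := hφ (y - x) (sub_nonneg.mpr hxy)
  rw [map_sub] at this
  linarith

theorem map_le_add_of_isSelfAdjoint (φ : B →ₗ[ℝ] ℝ) (hφ : ∀ x : B, 0 ≤ x → 0 ≤ φ x) {x y : B}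
    (hxy : IsSelfAdjoint (x - y)) : φ x ≤ φ y + ‖x - y‖ * φ 1 := by
  have h1 := monotone_of_nonneg_map φ hφ hxy.le_algebraMap_norm_self
  rw [Algebra.algebraMap_eq_smul_one, map_smul, map_sub, smul_eq_mul] at h1
  linarith

theorem root_eq_cfc {n : ℕ} (hn : n ≠ 0) {b : B} (hb : 0 ≤ b) :
    root n b = cfc (fun t : ℝ => t ^ (1 / n : ℝ)) b := by
  have h : (0 : ℝ≥0) < 1 / (n : ℝ≥0) := by positivity
  rw [root, CFC.nnrpow_eq_pow, CFC.nnrpow_eq_rpow h, CFC.rpow_eq_cfc_real]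
  simp

/-- A pointwise inequality on `[0, ‖b‖]` integrates against a positive functional. -/
theorem map_cfc_le (φ : B →ₗ[ℝ] ℝ) (hφ : ∀ x : B, 0 ≤ x → 0 ≤ φ x) {b : B} {f g : ℝ → ℝ}
    (hb : 0 ≤ b) (hf : ContinuousOn f (Set.Ici 0)) (hg : ContinuousOn g (Set.Ici 0)) {K η : ℝ}
    (hfg : ∀ t, 0 ≤ t → t ≤ ‖b‖ → f t ≤ K * g t + η) :
    φ (cfc f b) ≤ K * φ (cfc g b) + η * φ 1 := by
  have hf' := continuousOn_spectrum_of_nonneg hf hb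
  have hg' := continuousOn_spectrum_of_nonneg hg hb
  have h1 : cfc f b ≤ K • cfc g b + η • (1 : B) := by
    rw [← cfc_const_mul K g b hg', ← Algebra.algebraMap_eq_smul_one, ← cfc_const η b,
      ← cfc_add (a := b) _ _ (hg'.const_mul K) continuousOn_const]
    refine cfc_mono (fun t ht => ?_) hf' ((hg'.const_mul K).add continuousOn_const)
    exact hfg t (spectrum_nonneg_of_nonneg hb ht) ((le_abs_self t).trans (by
      have h2 : ‖(1 : B)‖ ≤ 1 := norm_le_one_of_star_mul_self_eq_one (by simp)
      calc |t| ≤ ‖b‖ * ‖(1 : B)‖ := spectrum.norm_le_norm_mul_of_mem ht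
        _ ≤ ‖b‖ * 1 := by gcongr
        _ = ‖b‖ := mul_one _))
  have h2 := monotone_of_nonneg_map φ hφ h1
  simpa using h2

theorem continuousOn_rpow_root (n : ℕ) :
    ContinuousOn (fun t : ℝ => t ^ (1 / n : ℝ)) (Set.Ici 0) :=
  (Real.continuous_rpow_const (by positivity)).continuousOn

theorem tendsto_rpow_one_div {c : ℝ} (hc : 0 < c) :
    Tendsto (fun n : ℕ => c ^ (1 / n : ℝ)) atTop (𝓝 1) := by
  have := (Real.continuousAt_const_rpow (a := c) (b := 0) hc.ne').tendsto.comp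
    (tendsto_const_div_atTop_nhds_zero_nat (1 : ℝ))
  simpa [Function.comp_def] using this

/-- The limit of `φ (b^{1/n})` is also the supremum over `δ > 0` of `φ (b (b + δ)⁻¹)`: both
`t^{1/n}` and `t / (t + δ)` approximate the indicator function of `(0, ∞)`. -/
theorem limit_root_le_iff (φ : B →ₗ[ℝ] ℝ) (hφ : ∀ x : B, 0 ≤ x → 0 ≤ φ x) {b : B} (hb : 0 ≤ b)
    {L : ℝ} (hL : Tendsto (fun n : ℕ => φ (root n b)) atTop (𝓝 L)) (l : ℝ) :
    L ≤ l ↔ ∀ δ > 0, φ (b * shiftInv δ b) ≤ l := by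
  have hφ1 : 0 ≤ φ 1 := hφ 1 zero_le_one
  constructor
  · intro hl δ hδ
    refine le_trans ?_ hl
    refine le_of_forall_pos_le_add fun ε hε => ?_
    obtain ⟨η, hη, hη1, hηε⟩ : ∃ η : ℝ, 0 < η ∧ η < 1 ∧ η * φ 1 ≤ ε := by
      refine ⟨min (1 / 2) (ε / (φ 1 + 1)), by positivity,
        (min_le_left _ _).trans_lt (by norm_num), ?_⟩
      calc _ ≤ ε / (φ 1 + 1) * φ 1 := by gcongr; exact min_le_right _ _
        _ ≤ ε := by
          rw [div_mul_eq_mul_div, div_le_iff₀ (by positivity)]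
          nlinarith
    have hev : ∀ᶠ n : ℕ in atTop, φ (b * shiftInv δ b) ≤ φ (root n b) + η * φ 1 := by
      filter_upwards [(tendsto_rpow_one_div (mul_pos hη hδ)).eventually
        (lt_mem_nhds (by linarith : 1 - η < 1)), eventually_ne_atTop 0] with n hn hn0
      rw [mul_shiftInv hδ hb, root_eq_cfc hn0 hb]
      have := map_cfc_le φ hφ hb (continuousOn_div_add hδ) (continuousOn_rpow_root n) (K := 1)
        (η := η) fun t ht _ => ?_
      · rwa [one_mul] at this
      · rw [one_mul]
        rcases le_total t (η * δ) with h | h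
        · have h1 : t / (t + δ) ≤ η := by
            rw [div_le_iff₀ (by positivity)]
            nlinarith
          have := Real.rpow_nonneg ht (1 / n : ℝ)
          linarith
        · have h1 : t / (t + δ) ≤ 1 := by
            rw [div_le_one (by positivity)]
            linarith
          have h2 : (η * δ) ^ (1 / n : ℝ) ≤ t ^ (1 / n : ℝ) :=
            Real.rpow_le_rpow (by positivity) h (by positivity)
          linarith
    have := ge_of_tendsto (hL.add_const (η * φ 1)) hev
    linarith
  · intro h
    have hK : 0 < max 1 ‖b‖ := lt_of_lt_of_le one_pos (le_max_left _ _)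
    have key : ∀ n : ℕ, n ≠ 0 → φ (root n b) ≤ max 1 ‖b‖ ^ (1 / n : ℝ) * l := by
      intro n hn
      refine le_of_forall_pos_le_add fun ε hε => ?_
      set K := max 1 ‖b‖ ^ (1 / n : ℝ) with hKdef
      have hK0 : 0 < K := Real.rpow_pos_of_pos hK _
      obtain ⟨η, hη, hηε⟩ : ∃ η : ℝ, 0 < η ∧ η * φ 1 ≤ ε := by
        refine ⟨ε / (φ 1 + 1), by positivity, ?_⟩
        rw [div_mul_eq_mul_div, div_le_iff₀ (by positivity)]
        nlinarith
      -- For `t ≥ η ^ n` this choice of `δ` gives `K * (δ / t) ≤ η`.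
      have hδ : 0 < η ^ n * (η / K) := by positivity
      have := map_cfc_le φ hφ hb (continuousOn_rpow_root n) (continuousOn_div_add hδ) (K := K)
        (η := η) fun t ht htb => ?_
      · rw [← root_eq_cfc hn hb, ← mul_shiftInv hδ hb] at this
        calc _ ≤ _ := this
          _ ≤ K * l + ε := by gcongr; exact h _ hδ
      · rcases le_total t (η ^ n) with h1 | h1
        · have h2 : t ^ (1 / n : ℝ) ≤ η := by
            rw [one_div, Real.rpow_inv_le_iff_of_pos ht hη.le (by positivity), Real.rpow_natCast]
            exact h1
          have : 0 ≤ K * (t / (t + η ^ n * (η / K))) := by positivity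
          linarith
        · have h2 : t ^ (1 / n : ℝ) ≤ K :=
            Real.rpow_le_rpow ht (htb.trans (le_max_right _ _)) (by positivity)
          have ht0 : 0 < t := lt_of_lt_of_le (by positivity) h1
          have h3 : K ≤ K * (t / (t + η ^ n * (η / K))) + η := by
            rw [← sub_le_iff_le_add, mul_div_assoc', le_div_iff₀ (by positivity)]
            have : K * (η ^ n * (η / K)) = η ^ n * η := by field_simp
            nlinarith
          linarith
    have h1 := (tendsto_rpow_one_div hK).mul_const l
    rw [one_mul] at h1
    refine le_of_tendsto_of_tendsto hL h1 ?_
    filter_upwards [eventually_ne_atTop 0] with n hn using key n hn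

end ResolventTrace

section DimensionFunction

variable {A : Type*} [CStarAlgebra A]

/-- The trace property `τ(x⋆ x) = τ(x x⋆)` polarises. -/
theorem TracialState.map_mul_comm (τ : TracialState A) (x y : A) :
    τ.toLinearMap (x * y) = τ.toLinearMap (y * x) := by
  have h : ∀ x y : A, τ.toLinearMap (star x * y) + τ.toLinearMap (star y * x) =
      τ.toLinearMap (y * star x) + τ.toLinearMap (x * star y) := by
    intro x y
    have h1 : τ.toLinearMap (star (x + y) * (x + y)) = τ.toLinearMap ((x + y) * star (x + y)) :=
      τ.tracial' _
    have h2 : τ.toLinearMap (star x * x) = τ.toLinearMap (x * star x) := τ.tracial' _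
    have h3 : τ.toLinearMap (star y * y) = τ.toLinearMap (y * star y) := τ.tracial' _
    simp only [star_add, add_mul, mul_add, map_add] at h1
    linear_combination h1 - h2 - h3
  have h1 := h (star x) y
  have h2 := h (star x) (Complex.I • y)
  simp only [star_smul, star_star, mul_smul_comm, smul_mul_assoc, map_smul, smul_eq_mul,
    Complex.star_def, Complex.conj_I] at h1 h2
  linear_combination (1 / 2) * h1 - (Complex.I / 2) * h2 + (1 / 2) *
    (τ.toLinearMap (x * y) - τ.toLinearMap (star y * star x) - τ.toLinearMap (y * x)
      + τ.toLinearMap (star x * star y)) * (Complex.I_sq)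

theorem matTrace_rect_mul_comm (τ : TracialState A) {m n : ℕ} (u : CStarMatrix (Fin m) (Fin n) A)
    (v : CStarMatrix (Fin n) (Fin m) A) : matTrace τ (u * v) = matTrace τ (v * u) := by
  simp only [matTrace, CStarMatrix.mul_apply, map_sum]
  rw [Finset.sum_comm]
  simp only [τ.map_mul_comm]

variable [PartialOrder A] [StarOrderedRing A]

/-- The extension of a trace to matrices as a real-linear functional. -/
noncomputable def matTraceₗ (τ : TracialState A) (n : ℕ) :
    CStarMatrix (Fin n) (Fin n) A →ₗ[ℝ] ℝ where
  toFun x := matTrace τ x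
  map_add' x y := by simp [matTrace, Finset.sum_add_distrib]
  map_smul' r x := by
    have : ∀ i, (r • x) i i = (r : ℂ) • x i i := fun i => rfl
    simp [matTrace, this, Finset.mul_sum]

theorem dimFn_le_iff (τ : TracialState A) (a : PosMat A) (l : ℝ) :
    dimFn τ a ≤ l ↔ ∀ δ > 0, matTrace τ (a.mat * shiftInv δ a.mat) ≤ l :=
  limit_root_le_iff (matTraceₗ τ a.size) (fun x hx => matTrace_nonneg τ x hx) a.nonneg
    (tendsto_dimFn τ a) l

/-- The intertwining relation `y⋆ (y y⋆ + δ)⁻¹ = (y⋆ y + δ)⁻¹ y⋆`. -/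
theorem conjTranspose_mul_shiftInv {m n : ℕ} (y : CStarMatrix (Fin m) (Fin n) A) {δ : ℝ}
    (hδ : 0 < δ) (h1 : 0 ≤ y * y.conjTranspose) (h2 : 0 ≤ y.conjTranspose * y) :
    y.conjTranspose * shiftInv δ (y * y.conjTranspose)
      = shiftInv δ (y.conjTranspose * y) * y.conjTranspose := by
  set R := shiftInv δ (y * y.conjTranspose)
  set R' := shiftInv δ (y.conjTranspose * y)
  have e1 : y * y.conjTranspose * R + δ • R = 1 := mul_shiftInv_add hδ h1
  have e2 : R' * (y.conjTranspose * y) + δ • R' = 1 := shiftInv_mul_add hδ h2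
  have e3 : R' * (y.conjTranspose * (y * y.conjTranspose * R + δ • R))
      = (R' * (y.conjTranspose * y) + δ • R') * (y.conjTranspose * R) := by
    rw [CStarMatrix.mul_add, CStarMatrix.mul_add, CStarMatrix.add_mul, CStarMatrix.mul_smul,
      CStarMatrix.mul_smul, CStarMatrix.smul_mul]
    simp only [rect_mul_assoc]
  rw [e1, e2, rect_mul_one, rect_one_mul] at e3
  exact e3.symm

/-- The trace of `a (a + δ)⁻¹` can only increase, up to changing `δ`, when `a` is a conjugate of a
positive `b`: writing `a = y y⋆`, it is the trace of the same function of `y⋆ y`, which is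
dominated by a multiple of `b`. -/
theorem matTrace_mul_shiftInv_le (τ : TracialState A) (b : PosMat A) {m : ℕ}
    {x : CStarMatrix (Fin m) (Fin m) A} (hx : x ∈ conjSet (Fin m) b.mat) {δ : ℝ} (hδ : 0 < δ) :
    matTrace τ (x * shiftInv δ x) ≤ dimFn τ b := by
  obtain ⟨v, rfl⟩ := hx
  obtain ⟨r, hr, hrr⟩ := exists_isSelfAdjoint_mul_self b.nonneg
  have hV : 0 ≤ v.conjTranspose * v := by
    simpa [rect_conjTranspose_conjTranspose] using rect_mul_conjTranspose_nonneg v.conjTranspose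
  set V := v.conjTranspose * v with hVdef
  set y := v * r with hy
  have hys : y.conjTranspose = r * v.conjTranspose := by
    rw [hy, rect_conjTranspose_mul, conjTranspose_eq_star, hr]
  have e1 : v * b.mat * v.conjTranspose = y * y.conjTranspose := by
    rw [hys, hy, ← hrr]; simp only [rect_mul_assoc]
  have e2 : y.conjTranspose * y = r * V * r := by
    rw [hys, hy, hVdef]; simp only [rect_mul_assoc]
  have h1 : 0 ≤ y * y.conjTranspose := rect_mul_conjTranspose_nonneg y
  have h2 : 0 ≤ y.conjTranspose * y := by
    simpa [rect_conjTranspose_conjTranspose] using rect_mul_conjTranspose_nonneg y.conjTranspose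
  have hC : 0 < ‖V‖ + 1 := by positivity
  have h3 : y.conjTranspose * y ≤ (‖V‖ + 1) • b.mat := by
    rw [e2, ← hrr, add_smul, one_smul]
    exact (mul_mul_le_norm_smul hr hV).trans (le_add_of_nonneg_right (hrr ▸ b.nonneg))
  rw [e1, rect_mul_assoc, conjTranspose_mul_shiftInv y hδ h1 h2, matTrace_rect_mul_comm,
    rect_mul_assoc, shiftInv_mul hδ h2, ← mul_shiftInv hδ h2]
  refine (monotone_of_nonneg_map (matTraceₗ τ b.size) (fun x hx => matTrace_nonneg τ x hx)
    (mul_shiftInv_le_of_le_smul hδ hC h2 b.nonneg h3)).trans ?_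
  exact (dimFn_le_iff τ b _).1 le_rfl _ (by positivity)

/-- The dimension function is monotone (take a constant family `b`) and lower semicontinuous for
approximate conjugation. -/
theorem dimFn_le_of_mem_closure (τ : TracialState A) {ι : Type*} {a : PosMat A} {b : ι → PosMat A}
    (ha : a.mat ∈ closure (⋃ i, conjSet (Fin a.size) (b i).mat)) {l : ℝ}
    (hl : ∀ i, dimFn τ (b i) ≤ l) : dimFn τ a ≤ l := by
  rw [dimFn_le_iff]
  intro δ hδ
  have h1 : 0 ≤ matTrace τ (1 : CStarMatrix (Fin a.size) (Fin a.size) A) :=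
    matTrace_nonneg τ 1 zero_le_one
  set T := matTrace τ (1 : CStarMatrix (Fin a.size) (Fin a.size) A) with hT
  refine le_of_forall_pos_le_add fun ε hε => ?_
  obtain ⟨x, hx, hxa⟩ := Metric.mem_closure_iff.1 ha (ε * δ / (T + 1)) (by positivity)
  obtain ⟨i, hi⟩ := Set.mem_iUnion.1 hx
  have hx0 : 0 ≤ x := by
    obtain ⟨v, rfl⟩ := hi
    exact conj_nonneg v (b i).nonneg
  have h2 := map_le_add_of_isSelfAdjoint (matTraceₗ τ a.size) (fun x hx => matTrace_nonneg τ x hx)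
    (x := a.mat * shiftInv δ a.mat) (y := x * shiftInv δ x)
    (by
      rw [mul_shiftInv hδ a.nonneg, mul_shiftInv hδ hx0]
      exact (cfc_predicate _ _ : IsSelfAdjoint _).sub (cfc_predicate _ _))
  have h3 := norm_mul_shiftInv_sub_le hδ a.nonneg hx0
  have h4 : ‖a.mat * shiftInv δ a.mat - x * shiftInv δ x‖ * T ≤ ε := by
    rw [dist_eq_norm] at hxa
    calc _ ≤ ε * δ / (T + 1) / δ * T := by gcongr; exact h3.trans (by gcongr)
      _ = ε * (T / (T + 1)) := by field_simp
      _ ≤ ε * 1 := by gcongr; rw [div_le_one (by positivity)]; linarith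
      _ = ε := mul_one ε
  calc _ ≤ _ := h2
    _ ≤ l + ε := add_le_add ((matTrace_mul_shiftInv_le τ (b i) hi hδ).trans (hl i)) h4

end DimensionFunction

end Cuntz

theorem mainTheorem8 {A : Type*} [CStarAlgebra A] [PartialOrder A] [StarOrderedRing A]
    [TopologicalSpace.SeparableSpace A]
    (hsr : Dense {x : A | IsUnit x})
    (a : ℕ → Cuntz.PosMat A)
    (hmono : Monotone fun n => Cuntz.cls (a n))
    (hbdd : BddAbove (Set.range fun n => Cuntz.cls (a n))) :
    (∃ s : Cuntz.W A, IsLUB (Set.range fun n => Cuntz.cls (a n)) s) ∧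
    ∀ aInf : Cuntz.PosMat A, IsLUB (Set.range fun n => Cuntz.cls (a n)) (Cuntz.cls aInf) →
      ∀ τ : Cuntz.TracialState A,
        IsLUB (Set.range fun n => Cuntz.dimFn τ (a n)) (Cuntz.dimFn τ aInf) := by
  have ha : ∀ n m, n ≤ m → Cuntz.Subequiv (a n) (a m) := fun n m h => hmono h
  obtain ⟨C, hC⟩ := hbdd
  induction C using Quotient.inductionOn with | _ c => ?_
  have hc : ∀ n, Cuntz.Subequiv (a n) c := fun n => hC ⟨n, rfl⟩
  obtain ⟨s, hs, hcl⟩ := Cuntz.exists_upperBound_mem_closure hsr ha hc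
  have hlub := Cuntz.isLUB_of_mem_closure hs hcl
  refine ⟨⟨_, hlub⟩, fun aInf hInf τ => ?_⟩
  obtain ⟨h1, -⟩ := (Cuntz.cls_eq_cls aInf s).1 (hInf.unique hlub)
  refine ⟨?_, fun l hl => ?_⟩
  · rintro _ ⟨n, rfl⟩
    have h2 : Cuntz.Subequiv (a n) aInf := hInf.1 ⟨n, rfl⟩
    refine Cuntz.dimFn_le_of_mem_closure τ (b := fun _ : Unit => aInf) ?_ fun _ => le_rfl
    rw [Set.iUnion_const]
    exact (Cuntz.subequiv_iff_mem_closure _ _).1 h2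
  · refine Cuntz.dimFn_le_of_mem_closure τ (b := a) ?_ fun n => hl ⟨n, rfl⟩
    refine Cuntz.mem_closure_of_mem_closure_conjSet (fun y hy v => ?_) hcl
      ((Cuntz.subequiv_iff_mem_closure _ _).1 h1)
    obtain ⟨n, hn⟩ := Set.mem_iUnion.1 hy
    exact Set.mem_iUnion.2 ⟨n, Cuntz.conj_mem_conjSet_of_mem v hn⟩
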